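/- Let $V^{2n}$ be a real vector space of dimension $2n$ with a complex structure $J\in\mathrm{Aut}(V)$, $J^2=-I$, and let $U^p$ be a real vector space of dimension $p$ with a positive definite inner product $\langle\,,\rangle$. Let $W^{p,p}=U^p\oplus U^p$, with first projection $\pi_1\colon W^{p,p}\to U^p$, be endowed with the inner product of signature $(p,p)$ $$\langle\!\langle(\xi_1,\xi_2),(\eta_1,\eta_2)\rangle\!\rangle=\langle\xi_1,\eta_1\rangle-\langle\xi_2,\eta_2\rangle .$$ For a bilinear form $\varphi\colon V\times V\to W$ let $\mathcal S(\varphi)=\mathrm{span}\{\varphi(X,Y): X,Y\in V\}$, and let $\nu(\varphi)$ be the dimension of $\mathcal N(\varphi)=\{Y\in V:\varphi(X,Y)=0\ \text{for all}\ X\in V\}$. The form $\varphi$ is called flat if $\langle\!\langle\varphi(X,Y),\varphi(Z,T)\rangle\!\rangle=\langle\!\langle\varphi(X,T),\varphi(Z,Y)\rangle\!\rangle$ for all $X,Y,Z,T\in V$. A subspace $L\subset W$ is degenerate if $L\cap L^\perp\neq 0$, where $\perp$ refers to $\langle\!\langle\,,\rangle\!\rangle$, and nondegenerate otherwise. Let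 $\alpha\colon V^{2n}\times V^{2n}\to U^p$ be a symmetric bilinear form, and let $\gamma,\beta\colon V^{2n}\times V^{2n}\to W^{p,p}$ be given by $$\gamma(X,Y)=(\alpha(X,Y),\alpha(X,JY)),\qquad \beta(X,Y)=\gamma(X,Y)+\gamma(JX,JY).$$ Assume that $p\le n$, that $\gamma$ and $\beta$ are flat, and that $$\langle\!\langle\beta(X,Y),\gamma(Z,T)\rangle\!\rangle=\langle\!\langle\beta(X,T),\gamma(Z,Y)\rangle\!\rangle\quad\text{for all } X,Y,Z,T\in V^{2n}.$$ If $p\le 11$ and $\nu(\gamma)<2n-\dim\mathcal S(\gamma)$, then $\mathcal S(\gamma)$ is degenerate. Moreover, if $\Omega=\pi_1(\mathcal S(\gamma)\cap\mathcal S(\gamma)^\perp)$ and $U^p=\Omega\oplus P$ is the orthogonal decomposition, with orthogonal projections $\pi_\Omega$, $\pi_P$, then: (i) There is an isometric complex structure $\mathcal J\in\mathrm{End}(\Omega)$, that is, $\mathcal J^2=-I$ and $\langle\mathcal J\xi,\mathcal J\eta\rangle=\langle\xi,\eta\rangle$ for all $\xi,\eta\in\Omega$, such that $\alpha_\Omega=\pi_\Omega\circ\alpha$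 satisfies $\mathcal J\alpha_\Omega(X,Y)=\alpha_\Omega(X,JY)$ for all $X,Y\in V^{2n}$. (ii) The bilinear form $\gamma_P=(\pi_P\times\pi_P)\circ\gamma$ is flat, the subspace $\mathcal S(\gamma_P)$ is nondegenerate, and $\nu(\gamma_P)\ge 2n-\dim\mathcal S(\gamma_P)$. -/

import Mathlib

noncomputable section

namespace FlatForms

open Module

section Bilinear

variable {V₁ V₂ W : Type*} [AddCommGroup V₁] [Module ℝ V₁] [AddCommGroup V₂] [Module ℝ V₂]
  [AddCommGroup W] [Module ℝ W]

/-- The image `S(φ)` of a bilinear form: the span of all its values. -/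
def image (φ : V₁ →ₗ[ℝ] V₂ →ₗ[ℝ] W) : Submodule ℝ W :=
  Submodule.span ℝ {w | ∃ X Y, φ X Y = w}

/-- The (right) nullity `N(φ) = {Y | φ(X, Y) = 0 for all X}`. -/
def nullity (φ : V₁ →ₗ[ℝ] V₂ →ₗ[ℝ] W) : Submodule ℝ V₂ where
  carrier := {Y | ∀ X, φ X Y = 0}
  add_mem' := by
    intro a b ha hb X
    rw [map_add, ha X, hb X, add_zero]
  zero_mem' := by
    intro X
    exact map_zero _
  smul_mem' := by
    intro c a ha X
    rw [map_smul, ha X, smul_zero]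

/-- The index of nullity `ν(φ) = dim N(φ)`. -/
def nu (φ : V₁ →ₗ[ℝ] V₂ →ₗ[ℝ] W) : ℕ := finrank ℝ (nullity φ)

/-- `φ` is flat with respect to the inner product `B` (of any signature) on `W`. -/
def IsFlat (B : LinearMap.BilinForm ℝ W) (φ : V₁ →ₗ[ℝ] V₂ →ₗ[ℝ] W) : Prop :=
  ∀ (X Z : V₁) (Y T : V₂), B (φ X Y) (φ Z T) - B (φ X T) (φ Z Y) = 0

end Bilinear

/-- A subspace `L` is degenerate with respect to `B` if `L ∩ L^⊥ ≠ 0`, where the orthogonal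
complement is taken with respect to `B`. -/
def IsDegenerate {W : Type*} [AddCommGroup W] [Module ℝ W]
    (B : LinearMap.BilinForm ℝ W) (L : Submodule ℝ W) : Prop :=
  L ⊓ B.orthogonal L ≠ ⊥

section Doubled

variable (U : Type*) [NormedAddCommGroup U] [InnerProductSpace ℝ U]

/-- The inner product of signature `(p, p)` on `W = U ⊕ U`, `p = dim U`:
`⟪⟪(ξ₁, ξ₂), (η₁, η₂)⟫⟫ = ⟪ξ₁, η₁⟫ - ⟪ξ₂, η₂⟫`. -/
def pairing : LinearMap.BilinForm ℝ (U × U) :=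
  (innerₗ U).compl₁₂ (LinearMap.fst ℝ U U) (LinearMap.fst ℝ U U)
    - (innerₗ U).compl₁₂ (LinearMap.snd ℝ U U) (LinearMap.snd ℝ U U)

variable {U}

theorem pairing_apply (v w : U × U) :
    pairing U v w = inner ℝ v.1 w.1 - inner ℝ v.2 w.2 := rfl

variable {V : Type*} [AddCommGroup V] [Module ℝ V]

/-- `γ(X, Y) = (α(X, Y), α(X, JY))`. -/
def gamma (J : V →ₗ[ℝ] V) (α : V →ₗ[ℝ] V →ₗ[ℝ] U) : V →ₗ[ℝ] V →ₗ[ℝ] U × U :=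
  α.compr₂ (LinearMap.inl ℝ U U) + (α.compl₂ J).compr₂ (LinearMap.inr ℝ U U)

theorem gamma_apply (J : V →ₗ[ℝ] V) (α : V →ₗ[ℝ] V →ₗ[ℝ] U) (X Y : V) :
    gamma J α X Y = (α X Y, α X (J Y)) := by
  simp [gamma]

/-- `β(X, Y) = γ(X, Y) + γ(JX, JY)`. -/
def beta (J : V →ₗ[ℝ] V) (α : V →ₗ[ℝ] V →ₗ[ℝ] U) : V →ₗ[ℝ] V →ₗ[ℝ] U × U :=
  gamma J α + (gamma J α).compl₁₂ J J

theorem beta_apply (J : V →ₗ[ℝ] V) (α : V →ₗ[ℝ] V →ₗ[ℝ] U) (X Y : V) :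
    beta J α X Y = gamma J α X Y + gamma J α (J X) (J Y) := rfl

/-- `Ω(γ) = π₁(S(γ) ∩ S(γ)^⊥)`, where `π₁` is the first projection of `U ⊕ U`. -/
def omega (γ : V →ₗ[ℝ] V →ₗ[ℝ] U × U) : Submodule ℝ U :=
  (image γ ⊓ (pairing U).orthogonal (image γ)).map (LinearMap.fst ℝ U U)

/-- The orthogonal projection `π_L : U → L`, as a linear map. -/
def proj (L : Submodule ℝ U) [L.HasOrthogonalProjection] : U →ₗ[ℝ] L :=
  L.orthogonalProjectionOnto.toLinearMap

/-- The component `α_L = π_L ∘ α` of a `U`-valued bilinear form. -/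
def comp (L : Submodule ℝ U) [L.HasOrthogonalProjection] (α : V →ₗ[ℝ] V →ₗ[ℝ] U) :
    V →ₗ[ℝ] V →ₗ[ℝ] L :=
  α.compr₂ (proj L)

/-- The component `γ_L = π_{L × L} ∘ γ` of a `U ⊕ U`-valued bilinear form. -/
def compProd (L : Submodule ℝ U) [L.HasOrthogonalProjection] (γ : V →ₗ[ℝ] V →ₗ[ℝ] U × U) :
    V →ₗ[ℝ] V →ₗ[ℝ] L × L :=
  γ.compr₂ ((proj L).prodMap (proj L))

end Doubled

end FlatForms

end

/-!
Write `V` as a complex space by means of `J`, and `W = U ⊕ U` as the complex space `U ⊗ ℂ`, where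
the imaginary unit is `rotate U`. Then `γ` is complex linear in its second argument, and the
pairing is the real part of a complex bilinear form. The radical `S(γ) ∩ S(γ)^⊥` is a complex null
subspace, so it is the graph of an isometric complex structure `𝒥` of `Ω`
(`exists_complexStructure`), and orthogonality to this graph says that `𝒥 α_Ω(X, Y) = α_Ω(X, JY)`
(`complexStructure_comp`). It follows that `γ_P` has the same pairings as `γ`
(`pairing_compProd`), so that it is flat with nondegenerate image. All that remains is to show
that `ν(γ) ≥ 2n - dim S(γ)` when `S(γ)` is nondegenerate (`finrank_le_nu_gamma_add`), and to apply
this to `γ` and to `γ_P`.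

Up to a factor, `β` is the sesquilinear part of `γ`. Its flatness and its hermitian symmetry imply
`⟪β(X, X), β(Y, Y)⟫ = |β(X, Y)|²`, and this positivity yields `codim N(β) ≤ dim S(β)`
(`finrank_le_of_hermitian`). On `M = N(β)` only the complex bilinear, symmetric part of `γ` is
left. Its values on `M` are orthogonal to the nondegenerate space `S(β)`, and therefore the
problem concerns a symmetric complex bilinear form `τ` with values in `S = S(γ) ∩ S(β)^⊥`, a space
of complex dimension at most `11`, for which `(a, c, d) ↦ b(τ(m, a), τ(c, d))` is symmetric for
each `m ∈ M`. In this way `M` is a space of cubic forms, and `S` a space of quadratic forms that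
contains their first derivatives. The claim is `dim M ≤ dim S` if `τ(m, ·) ≠ 0` for `m ≠ 0`
(`FlatOn.finrank_le_of_injective`). In the case `M = E` this is the unimodality of the Gorenstein
Hilbert function `(1, n, q, n, 1)` for `q ≤ 11`; Stanley's `(1, 13, 12, 13, 1)` shows that the
bound `11` is sharp there.

Suppose `dim M > dim S`, and let `X` be general. The cubics killed by `X` form a space `M[X]` of
dimension `dim M - r`, where `r = dim ∂_X M`, and their derivatives span a space of dimension `t`
with `t + r ≤ dim S ≤ 11`, as they are orthogonal to `∂_X M`. So `dim M[X] > t`. Bounds of the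
type of Green's hyperplane restriction theorem (`FlatOn.finrank_inf_ker_contract_le`,
`FlatOn.finrank_map_inf_ker_le`) leave only the case of `t = 3` and `dim M[X] = 4`, in which
exactly one cubic, up to a factor, is also killed by a second general vector `Y`, and it is the
cube of a linear form (`FlatOn.finrank_eq_of_lt`, `FlatOn.exists_cube`). Geometrically, `M`
contains the cubes of the lines that join general points of a plane. The squares of the six lines
through four points are linearly independent, and squares of distinct lines are orthogonal in `S`.
Two disjoint quadruples of points thus produce two orthogonal six-dimensional subspaces of the
nondegenerate space `S`, which requires `dim S ≥ 12`.
-/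

namespace FlatForms

open Module

/-! ### General points of a vector space -/

section Generic

variable {k E A C : Type*} [Field k] [AddCommGroup E] [Module k E] [AddCommGroup A] [Module k A]
  [AddCommGroup C] [Module k C]

/-- A property of the points of a vector space is generic if it holds wherever some function,
not identically zero and polynomial along every line, does not vanish. -/
def Generic (k : Type*) {E : Type*} [Field k] [AddCommGroup E] [Module k E] (P : E → Prop) :
    Prop :=
  ∃ f : E → k, (∀ X Y, ∃ p : Polynomial k, ∀ c : k, f (X + c • Y) = p.eval c) ∧
    (∃ X, f X ≠ 0) ∧ ∀ X, f X ≠ 0 → P X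

theorem Generic.exists {P : E → Prop} (h : Generic k P) : ∃ X, P X := by
  obtain ⟨f, -, ⟨X, hX⟩, h⟩ := h
  exact ⟨X, h X hX⟩

theorem Generic.mono {P Q : E → Prop} (h : Generic k P) (hPQ : ∀ X, P X → Q X) :
    Generic k Q := by
  obtain ⟨f, h1, h2, h3⟩ := h
  exact ⟨f, h1, h2, fun X hX => hPQ X (h3 X hX)⟩

theorem Generic.true : Generic k (fun _ : E => True) :=
  ⟨fun _ => 1, fun _ _ => ⟨1, by simp⟩, ⟨0, one_ne_zero⟩, fun _ _ => trivial⟩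

theorem Generic.and [Infinite k] {P Q : E → Prop} (hP : Generic k P) (hQ : Generic k Q) :
    Generic k (fun X => P X ∧ Q X) := by
  obtain ⟨f, hf, ⟨X, hX⟩, hfP⟩ := hP
  obtain ⟨g, hg, ⟨Y, hY⟩, hgQ⟩ := hQ
  refine ⟨fun Z => f Z * g Z, fun Z Z' => ?_, ?_, fun Z hZ =>
    ⟨hfP Z (left_ne_zero_of_mul hZ), hgQ Z (right_ne_zero_of_mul hZ)⟩⟩
  · obtain ⟨p, hp⟩ := hf Z Z'
    obtain ⟨q, hq⟩ := hg Z Z'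
    exact ⟨p * q, fun c => by simp [hp, hq]⟩
  -- On the line through `X` and `Y` neither function vanishes identically.
  · obtain ⟨p, hp⟩ := hf X (Y - X)
    obtain ⟨q, hq⟩ := hg X (Y - X)
    have hp0 : p ≠ 0 := by
      rintro rfl
      have := hp 0
      simp at this
      exact hX this
    have hq0 : q ≠ 0 := by
      rintro rfl
      have := hq 1
      simp at this
      exact hY this
    by_contra! hcon
    refine mul_ne_zero hp0 hq0 (Polynomial.funext fun c => ?_)
    rw [Polynomial.eval_mul, ← hp, ← hq, hcon, Polynomial.eval_zero]

theorem Generic.forall_mem [Infinite k] {ι : Type*} (s : Finset ι) {P : ι → E → Prop}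
    (h : ∀ i ∈ s, Generic k (P i)) : Generic k (fun X => ∀ i ∈ s, P i X) := by
  classical
  induction s using Finset.induction_on with
  | empty => exact Generic.true.mono (by simp)
  | insert i s _ ih =>
    refine ((h i (by simp)).and (ih fun j hj => h j (by simp [hj]))).mono ?_
    rintro X ⟨h1, h2⟩ j hj
    rcases Finset.mem_insert.1 hj with rfl | hj
    exacts [h1, h2 j hj]

theorem generic_ne_zero (f : E →ₗ[k] k) {X : E} (hX : f X ≠ 0) :
    Generic k (fun X => f X ≠ 0) :=
  ⟨f, fun X Y => ⟨Polynomial.C (f X) + Polynomial.C (f Y) * Polynomial.X,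
    fun c => by simpa using mul_comm _ _⟩,
    ⟨X, hX⟩, fun _ h => h⟩

/-- A point `X` is regular for a linear family `F` of linear maps, restricted to a subspace `L`,
if the rank of `F X` on `L` is maximal. -/
def Regular (F : E →ₗ[k] A →ₗ[k] C) (L : Submodule k A) (X : E) : Prop :=
  ∀ Y, finrank k (L.map (F Y)) ≤ finrank k (L.map (F X))

variable [FiniteDimensional k A]

theorem finrank_map_add_finrank_inf_ker (f : A →ₗ[k] C) (L : Submodule k A) :
    finrank k (L.map f) + finrank k (L ⊓ LinearMap.ker f : Submodule k A) = finrank k L := by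
  have h := LinearMap.finrank_range_add_finrank_ker (f.domRestrict L)
  rw [LinearMap.range_domRestrict, LinearMap.ker_domRestrict] at h
  rw [← h, ← Submodule.finrank_map_subtype_eq, Submodule.map_comap_subtype]

theorem exists_regular (F : E →ₗ[k] A →ₗ[k] C) (L : Submodule k A) : ∃ X, Regular F L X := by
  have hb : ∃ N, ∀ X, finrank k (L.map (F X)) ≤ N :=
    ⟨finrank k L, fun X => Submodule.finrank_map_le _ _⟩
  obtain ⟨N, hN⟩ := hb
  have : (Set.range fun X => finrank k (L.map (F X))).Nonempty := Set.range_nonempty _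
  obtain ⟨X, hX⟩ := Nat.sSup_mem this ⟨N, by rintro _ ⟨X, rfl⟩; exact hN X⟩
  refine ⟨X, fun Y => ?_⟩
  rw [show finrank k (L.map (F X)) = _ from hX]
  exact le_csSup ⟨N, by rintro _ ⟨X, rfl⟩; exact hN X⟩ ⟨Y, rfl⟩

/-- Maximality of the rank is an open condition: a minor of maximal size which does not vanish at
one point is a polynomial that certifies regularity. -/
theorem generic_regular (F : E →ₗ[k] A →ₗ[k] C) (L : Submodule k A) :
    Generic k (Regular F L) := by
  obtain ⟨X₀, hX₀⟩ := exists_regular F L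
  set r := finrank k (L.map (F X₀)) with hr
  let B : Basis (Fin r) k (L.map (F X₀)) := Module.finBasis k _
  have hB : LinearIndependent k (fun i => (B i : C)) :=
    B.linearIndependent.map' (L.map (F X₀)).subtype (Submodule.ker_subtype _)
  choose a ha haB using fun i => Submodule.mem_map.1 (B i).2
  obtain ⟨g, hg⟩ := LinearMap.exists_leftInverse_of_injective
    (Fintype.linearCombination k (fun i => (B i : C)))
    (LinearMap.ker_eq_bot.2 (linearIndependent_iff_injective_fintypeLinearCombination.1 hB))
  have hg' : ∀ i, g (B i) = Pi.single i 1 := fun i => by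
    have := LinearMap.congr_fun hg (Pi.single i 1)
    simpa using this
  let m : E → Matrix (Fin r) (Fin r) k := fun X => Matrix.of fun i j => g (F X (a i)) j
  refine ⟨fun X => (m X).det, fun X Y => ?_, ⟨X₀, ?_⟩, fun X hX Y => ?_⟩
  · let P : Matrix (Fin r) (Fin r) (Polynomial k) := Matrix.of fun i j =>
      Polynomial.C (m X i j) + Polynomial.C (m Y i j) * Polynomial.X
    refine ⟨P.det, fun c => ?_⟩
    rw [← Polynomial.coe_evalRingHom, RingHom.map_det]
    refine congrArg Matrix.det (Matrix.ext fun i j => ?_)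
    simp [P, m]
    exact mul_comm _ _
  · have : m X₀ = 1 := by
      ext i j
      simp [m, haB, hg', Matrix.one_apply, Pi.single_apply, eq_comm]
    simp [this]
  · refine (hX₀ Y).trans ?_
    have h1 : LinearIndependent k (fun i => F X (a i)) :=
      LinearIndependent.of_comp g (Matrix.linearIndependent_rows_of_det_ne_zero hX)
    have h2 : LinearIndependent k
        (fun i => (⟨F X (a i), Submodule.mem_map_of_mem (ha i)⟩ : L.map (F X))) :=
      LinearIndependent.of_comp (L.map (F X)).subtype h1
    simpa using h2.fintype_card_le_finrank

/-- Choosing points one after the other, each in general position with respect to the finite set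
of the earlier ones, produces a sequence. -/
theorem exists_seq_of_generic {P : Finset E → E → Prop} (h : ∀ s, Generic k (P s)) :
    ∃ x : ℕ → E, ∀ n, ∃ s : Finset E, (∀ i < n, x i ∈ s) ∧ P s (x n) := by
  classical
  choose c hc using fun s => (h s).exists
  let s : ℕ → Finset E := fun n => Nat.rec ∅ (fun _ t => insert (c t) t) n
  have hs : ∀ n, s (n + 1) = insert (c (s n)) (s n) := fun n => rfl
  have hmono : Monotone s := monotone_nat_of_le_succ fun n => by
    rw [hs]; exact Finset.subset_insert _ _
  refine ⟨fun n => c (s n), fun n => ⟨s n, fun i hi => ?_, hc _⟩⟩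
  exact hmono (Nat.succ_le_of_lt hi) (by rw [hs]; exact Finset.mem_insert_self _ _)

end Generic

/-! ### Contractions of quadratic and cubic forms -/

section Symmetric

variable {k E S : Type*} [Field k] [AddCommGroup E] [Module k E] [AddCommGroup S] [Module k S]

/-- The contraction `∂_Y v = b(v, τ(Y, ·))` of a vector `v`, seen as the quadratic form
`b(v, τ(·, ·))` on `E`, with a vector `Y`. -/
def contract (b : LinearMap.BilinForm k S) (τ : E →ₗ[k] E →ₗ[k] S) :
    E →ₗ[k] S →ₗ[k] Dual k E :=
  LinearMap.mk₂ k (fun Y v => (b v).comp (τ Y))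
    (fun _ _ _ => by ext; simp) (fun _ _ _ => by ext; simp)
    (fun _ _ _ => by ext; simp) (fun _ _ _ => by ext; simp)

theorem contract_apply (b : LinearMap.BilinForm k S) (τ : E →ₗ[k] E →ₗ[k] S) (Y : E) (v : S)
    (d : E) : contract b τ Y v d = b v (τ Y d) := rfl

/-- A symmetric bilinear form `τ` on `E`, whose values lie in a space with a symmetric bilinear
form `b` and detect every vector of it, and which is flat in the arguments from a subspace `M`:
for `m ∈ M` the form `(a, c, d) ↦ b(τ(m, a), τ(c, d))` is a symmetric trilinear form on `E`. -/
structure FlatOn (b : LinearMap.BilinForm k S) (τ : E →ₗ[k] E →ₗ[k] S) (M : Submodule k E) :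
    Prop where
  comm : ∀ v w, b v w = b w v
  symm : ∀ a c, τ a c = τ c a
  flat : ∀ m ∈ M, ∀ a c d, b (τ m a) (τ c d) = b (τ m c) (τ a d)
  separating : ∀ v, (∀ a c, b v (τ a c) = 0) → v = 0

variable {b : LinearMap.BilinForm k S} {τ : E →ₗ[k] E →ₗ[k] S} {M : Submodule k E}

theorem FlatOn.contract_comm (h : FlatOn b τ M) (Y Z : E) (v : S) :
    contract b τ Y v Z = contract b τ Z v Y := by
  rw [contract_apply, contract_apply, h.symm]

theorem FlatOn.finrank_add_le [FiniteDimensional k S] (h : FlatOn b τ M) {L L' : Submodule k S}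
    (hL : ∀ v ∈ L, ∀ w ∈ L', b v w = 0) : finrank k L + finrank k L' ≤ finrank k S := by
  have hle : L' ≤ b.orthogonal L := fun w hw v hv => hL v hv w hw
  have hbot : b.orthogonal ⊤ = ⊥ := by
    rw [eq_bot_iff]
    intro v hv
    exact h.separating v fun a c => by rw [h.comm]; exact hv _ trivial
  have h1 := LinearMap.BilinForm.finrank_add_finrank_orthogonal (B := b)
    (fun v w hvw => by rw [h.comm, hvw]) L
  rw [hbot, inf_bot_eq, finrank_bot, add_zero] at h1
  have := Submodule.finrank_mono hle
  omega

theorem FlatOn.contract_eq_zero (h : FlatOn b τ M) {a : E} (ha : a ∈ M) {Y : E}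
    (haY : τ Y a = 0) (Z : E) : contract b τ Y (τ Z a) = 0 := by
  ext d
  rw [contract_apply, h.symm Z a, h.flat a ha, h.symm a Y, haY, map_zero]
  rfl

variable [Infinite k] [FiniteDimensional k S]

/-- Contracting a space of quadratic forms with a regular vector `Y`: on the forms killed by `Y`
all contractions have smaller rank, since their values `∂_Z v` vanish at `Y`, whereas some
`∂_Z v` with `v ∈ I` does not. -/
theorem FlatOn.finrank_map_contract_lt (h : FlatOn b τ M) {I : Submodule k S} (hI : I ≠ ⊥) {Y : E}
    (hY : Regular (contract b τ) I Y) (W : E) :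
    finrank k ((I ⊓ LinearMap.ker (contract b τ Y)).map (contract b τ W)) <
      finrank k (I.map (contract b τ Y)) := by
  obtain ⟨v, hv, Z₀, hvZ⟩ : ∃ v ∈ I, ∃ Z, contract b τ Y v Z ≠ 0 := by
    obtain ⟨v, hv, hv0⟩ := Submodule.exists_mem_ne_zero_of_ne_bot hI
    obtain ⟨a, c, hac⟩ : ∃ a c, b v (τ a c) ≠ 0 := by
      by_contra! hcon
      exact hv0 (h.separating v hcon)
    have hne : I.map (contract b τ a) ≠ ⊥ := fun hbot => hac <| by
      have : contract b τ a v ∈ I.map (contract b τ a) := Submodule.mem_map_of_mem hv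
      rw [hbot, Submodule.mem_bot] at this
      rw [← contract_apply, this, LinearMap.zero_apply]
    have hpos : 0 < finrank k (I.map (contract b τ Y)) :=
      (Submodule.one_le_finrank_iff.2 hne).trans (hY a)
    obtain ⟨f, hf, hf0⟩ := Submodule.exists_mem_ne_zero_of_ne_bot
      (Submodule.one_le_finrank_iff.1 hpos)
    obtain ⟨w, hw, rfl⟩ := hf
    refine ⟨w, hw, ?_⟩
    by_contra! hcon
    exact hf0 (LinearMap.ext hcon)
  obtain ⟨Z, hZreg, hZ⟩ := ((generic_regular (contract b τ)
    (I ⊓ LinearMap.ker (contract b τ Y))).and (generic_ne_zero _ hvZ)).exists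
  refine (hZreg W).trans_lt (lt_of_lt_of_le ?_ (hY Z))
  refine Submodule.finrank_lt_finrank_of_lt (lt_of_le_of_ne (Submodule.map_mono inf_le_left) ?_)
  intro heq
  have hmem : contract b τ Z v ∈ I.map (contract b τ Z) := Submodule.mem_map_of_mem hv
  rw [← heq] at hmem
  obtain ⟨w, hw, hwv⟩ := hmem
  have hwY : contract b τ Y w = 0 := hw.2
  rw [h.contract_comm, ← hwv, ← h.contract_comm, hwY] at hZ
  exact hZ rfl

/-- A space of quadratic forms whose contractions have rank at most `δ` has dimension at most
`δ + (δ - 1) + ⋯ + 1`. -/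
theorem FlatOn.two_mul_finrank_le (h : FlatOn b τ M) (δ : ℕ) :
    ∀ (I : Submodule k S) (Y : E), Regular (contract b τ) I Y →
      finrank k (I.map (contract b τ Y)) ≤ δ → 2 * finrank k I ≤ δ * (δ + 1) := by
  induction δ with
  | zero =>
    intro I Y hY hδ
    by_cases hI : I = ⊥
    · rw [hI, finrank_bot]
    · have := h.finrank_map_contract_lt hI hY Y
      omega
  | succ δ ih =>
    intro I Y hY hδ
    by_cases hI : I = ⊥
    · rw [hI, finrank_bot]
      exact Nat.zero_le _
    obtain ⟨Z, hZ⟩ := exists_regular (contract b τ) (I ⊓ LinearMap.ker (contract b τ Y))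
    have h1 := ih _ Z hZ (by have := h.finrank_map_contract_lt hI hY Z; omega)
    have h2 := finrank_map_add_finrank_inf_ker (contract b τ Y) I
    nlinarith

theorem FlatOn.exists_finrank_inf_ker_contract (h : FlatOn b τ M) {I : Submodule k S}
    (hI : I ≠ ⊥) {Y : E} (hY : Regular (contract b τ) I Y) :
    ∃ δ, 2 * finrank k (I ⊓ LinearMap.ker (contract b τ Y) : Submodule k S) ≤ δ * (δ + 1) ∧
      δ + 1 + finrank k (I ⊓ LinearMap.ker (contract b τ Y) : Submodule k S) ≤ finrank k I := by
  obtain ⟨Z, hZ⟩ := exists_regular (contract b τ) (I ⊓ LinearMap.ker (contract b τ Y))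
  refine ⟨_, h.two_mul_finrank_le _ _ Z hZ le_rfl, ?_⟩
  have h1 := h.finrank_map_contract_lt hI hY Z
  have h2 := finrank_map_add_finrank_inf_ker (contract b τ Y) I
  omega

/-- An upper bound for the dimension of the space of those forms in an `r`-dimensional space of
quadratic forms which are killed by a regular vector. The values at `2`, `3` and `7` are those of
Green's bound `r_{<2>}`; other values up to `7` are rounded up to them, and beyond `7` the bound is
the trivial one. -/
def greenBound (r : ℕ) : ℕ := if r ≤ 2 then 0 else if r ≤ 3 then 1 else if r ≤ 7 then 3 else r

theorem greenBound_mono : Monotone greenBound := by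
  intro r s hrs
  unfold greenBound
  split_ifs <;> omega

theorem FlatOn.finrank_inf_ker_contract_le (h : FlatOn b τ M) {I : Submodule k S} {Y : E}
    (hY : Regular (contract b τ) I Y) :
    finrank k (I ⊓ LinearMap.ker (contract b τ Y) : Submodule k S) ≤ greenBound (finrank k I) := by
  by_cases hI : I = ⊥
  · rw [hI, bot_inf_eq, finrank_bot]
    exact Nat.zero_le _
  obtain ⟨δ, h1, h2⟩ := h.exists_finrank_inf_ker_contract hI hY
  unfold greenBound
  by_cases hδ : δ ≤ 2
  · interval_cases δ <;> split_ifs <;> omega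
  · split_ifs <;> omega

variable [FiniteDimensional k E]

/-- Passing from a space `A` of cubic forms to the space `A[Y]` of those killed by a regular
vector `Y`, the rank of the contractions drops as it does for spaces of quadratic forms. The
reason is that `∂_Z(A[Y])` lies in `(∂_Z A)[Y]`. -/
theorem FlatOn.finrank_map_inf_ker_le (h : FlatOn b τ M) {A : Submodule k E} (hA : A ≤ M) {Y : E}
    (hY : Regular τ A Y) (Z : E) :
    finrank k ((A ⊓ LinearMap.ker (τ Y)).map (τ Z)) ≤ greenBound (finrank k (A.map (τ Y))) := by
  -- `(Y₁, Z₁)` minimizes the dimension of `A[Y, Z]`. Replacing first `Z₁`, then `Y₁`, by general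
  -- vectors, the minimum is attained at a pair `(Y₀, Z₀)` with `Y₀` general for `∂_{Z₀} A`.
  let e : E × E → ℕ := fun p =>
    finrank k (A ⊓ LinearMap.ker (τ p.1) ⊓ LinearMap.ker (τ p.2) : Submodule k E)
  obtain ⟨⟨Y₁, Z₁⟩, hmin⟩ : ∃ p, ∀ q, e p ≤ e q :=
    ⟨Function.argmin e, fun q => Function.argmin_le e q⟩
  have hswap : ∀ Y Z, e (Y, Z) = e (Z, Y) := fun Y Z => by
    simp only [e]
    rw [inf_right_comm]
  have hreg : ∀ {Y Z Z'}, Regular τ (A ⊓ LinearMap.ker (τ Y)) Z → e (Y, Z) ≤ e (Y, Z') := by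
    intro Y Z Z' hZ
    have h1 := finrank_map_add_finrank_inf_ker (τ Z) (A ⊓ LinearMap.ker (τ Y))
    have h2 := finrank_map_add_finrank_inf_ker (τ Z') (A ⊓ LinearMap.ker (τ Y))
    have h3 := hZ Z'
    simp only [e]
    omega
  obtain ⟨Z₀, hZ₀⟩ := exists_regular τ (A ⊓ LinearMap.ker (τ Y₁))
  obtain ⟨Y₀, ⟨hY₀, hY₀A⟩, hY₀q⟩ := (((generic_regular τ (A ⊓ LinearMap.ker (τ Z₀))).and
    (generic_regular τ A)).and (generic_regular (contract b τ) (A.map (τ Z₀)))).exists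
  have he : e (Y₀, Z₀) ≤ e (Y, Z) := by
    rw [hswap]
    calc e (Z₀, Y₀) ≤ e (Z₀, Y₁) := hreg hY₀
      _ = e (Y₁, Z₀) := hswap _ _
      _ ≤ e (Y₁, Z₁) := hreg hZ₀
      _ ≤ e (Y, Z) := hmin _
  have hle : (A ⊓ LinearMap.ker (τ Y₀)).map (τ Z₀) ≤
      A.map (τ Z₀) ⊓ LinearMap.ker (contract b τ Y₀) := by
    rintro _ ⟨a, ha, rfl⟩
    exact ⟨Submodule.mem_map_of_mem ha.1, h.contract_eq_zero (hA ha.1) ha.2 Z₀⟩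
  have h1 := (Submodule.finrank_mono hle).trans (h.finrank_inf_ker_contract_le hY₀q)
  have h2 := greenBound_mono (hY Z₀)
  have h3 := finrank_map_add_finrank_inf_ker (τ Z₀) (A ⊓ LinearMap.ker (τ Y₀))
  have h4 := finrank_map_add_finrank_inf_ker (τ Z) (A ⊓ LinearMap.ker (τ Y))
  have h5 := finrank_map_add_finrank_inf_ker (τ Y₀) A
  have h6 := finrank_map_add_finrank_inf_ker (τ Y) A
  have h7 := hY Y₀
  have h8 := hY₀A Y
  simp only [e] at he
  omega

end Symmetric

/-! ### Spaces of cubic forms with few derivatives -/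

section Bound

variable {k E S : Type*} [Field k] [AddCommGroup E] [Module k E] [AddCommGroup S] [Module k S]
  {b : LinearMap.BilinForm k S} {τ : E →ₗ[k] E →ₗ[k] S} {M : Submodule k E}

/-- The contractions of the elements of `M` killed by `X` are orthogonal to `∂_X M`. -/
theorem FlatOn.orthogonal_map₂ (h : FlatOn b τ M) (X : E) {v w : S}
    (hv : v ∈ Submodule.map₂ τ (M ⊓ LinearMap.ker (τ X)) ⊤) (hw : w ∈ M.map (τ X)) :
    b v w = 0 := by
  obtain ⟨m, -, rfl⟩ := hw
  have hle : Submodule.map₂ τ (M ⊓ LinearMap.ker (τ X)) ⊤ ≤ LinearMap.ker (b.flip (τ X m)) := by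
    rw [Submodule.map₂_le]
    intro a ha e _
    have haX : τ X a = 0 := ha.2
    change b (τ a e) (τ X m) = 0
    rw [h.flat a ha.1, h.symm a X, haX, map_zero]
    rfl
  exact hle hv

theorem FlatOn.map_le_map₂ (h : FlatOn b τ M) (A : Submodule k E) (Z : E) :
    A.map (τ Z) ≤ Submodule.map₂ τ A ⊤ := by
  rintro _ ⟨a, ha, rfl⟩
  rw [h.symm]
  exact Submodule.apply_mem_map₂ _ ha trivial

theorem FlatOn.finrank_map_pos (h : FlatOn b τ M) (hM : ∀ m ∈ M, τ m = 0 → m = 0)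
    [FiniteDimensional k S] {A : Submodule k E} (hA : A ≤ M) (hA0 : A ≠ ⊥)
    {Y : E} (hY : Regular τ A Y) : 0 < finrank k (A.map (τ Y)) := by
  obtain ⟨a, ha, ha0⟩ := Submodule.exists_mem_ne_zero_of_ne_bot hA0
  obtain ⟨Z, hZ⟩ : ∃ Z, τ a Z ≠ 0 := by
    by_contra! hcon
    exact ha0 (hM a (hA ha) (LinearMap.ext hcon))
  refine (Submodule.one_le_finrank_iff.2 fun hbot => hZ ?_).trans (hY Z)
  have : τ Z a ∈ A.map (τ Z) := Submodule.mem_map_of_mem ha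
  rwa [hbot, Submodule.mem_bot, h.symm] at this

/-- If the form of values `τ(a, ·)` has rank one, then the cubic form of `a` is a multiple of the
cube of a linear form `w`, and its contractions are multiples of `w²`. -/
theorem FlatOn.exists_square (h : FlatOn b τ M) {a : E} (ha : a ∈ M) {N : Submodule k S}
    [FiniteDimensional k N] (hN : finrank k N ≤ 1) (haN : ∀ e, τ a e ∈ N) (ha0 : τ a ≠ 0) :
    ∃ (w : Dual k E) (v : S) (μ : k), μ ≠ 0 ∧ (∀ e, τ a e = w e • v) ∧
      ∀ c d, b v (τ c d) = μ * w c * w d := by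
  obtain ⟨e₀, he₀⟩ : ∃ e, τ a e ≠ 0 := by
    by_contra! hcon
    exact ha0 (LinearMap.ext hcon)
  have hN1 : finrank k N = 1 := le_antisymm hN <| Submodule.one_le_finrank_iff.2 fun hbot => he₀ <|
    by simpa [hbot] using haN e₀
  obtain ⟨g, hg⟩ : ∃ g : Dual k S, g (τ a e₀) ≠ 0 := by
    by_contra! hcon
    exact he₀ ((Module.forall_dual_apply_eq_zero_iff k _).1 hcon)
  set w : Dual k E := (g (τ a e₀))⁻¹ • g.comp (τ a) with hw
  have hτ : ∀ e, τ a e = w e • τ a e₀ := fun e => by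
    obtain ⟨c, hc⟩ := exists_smul_eq_of_finrank_eq_one hN1 (x := ⟨τ a e₀, haN e₀⟩)
      (fun h0 => he₀ (congrArg Subtype.val h0)) ⟨τ a e, haN e⟩
    have hc' : c • τ a e₀ = τ a e := congrArg Subtype.val hc
    rw [← hc']
    congr 1
    simp [hw, ← hc', mul_comm c, hg]
  have hw₀ : w e₀ = 1 := by simp [hw, hg]
  have hflat : ∀ c e d, w e * b (τ a e₀) (τ c d) = w c * b (τ a e₀) (τ e d) := fun c e d => by
    have := h.flat a ha e c d
    rw [hτ e, hτ c] at this
    simpa using this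
  have hb : ∀ c d, b (τ a e₀) (τ c d) = b (τ a e₀) (τ e₀ e₀) * w c * w d := fun c d => by
    have h1 := hflat c e₀ d
    have h2 := hflat d e₀ e₀
    rw [hw₀, one_mul] at h1 h2
    rw [h1, h.symm e₀ d, h2]
    ring
  refine ⟨w, τ a e₀, _, fun h0 => he₀ (h.separating _ fun c d => ?_), hτ, hb⟩
  rw [hb, h0, zero_mul, zero_mul]

variable [Infinite k] [FiniteDimensional k E] [FiniteDimensional k S]

/-- If `dim M` exceeds `dim S`, then the cubic forms in `M` killed by a general vector `X` behave
as the four-dimensional space of all binary cubic forms: their contractions form a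
three-dimensional space, and only one of them is killed by another general vector `Y`. -/
theorem FlatOn.finrank_eq_of_lt (h : FlatOn b τ M) (hM : ∀ m ∈ M, τ m = 0 → m = 0)
    (hS : finrank k S ≤ 11) (hlt : finrank k S < finrank k M) {X Y : E} (hX : Regular τ M X)
    (hY : Regular τ (M ⊓ LinearMap.ker (τ X)) Y) :
    finrank k (M ⊓ LinearMap.ker (τ X) ⊓ LinearMap.ker (τ Y) : Submodule k E) = 1 ∧
      finrank k (Submodule.map₂ τ (M ⊓ LinearMap.ker (τ X)) ⊤) = 3 := by
  set A := M ⊓ LinearMap.ker (τ X) with hA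
  have hAM : A ≤ M := inf_le_left
  set A' := A ⊓ LinearMap.ker (τ Y) with hA'
  have hAM' : A' ≤ M := inf_le_left.trans hAM
  obtain ⟨Z, hZ⟩ := exists_regular τ A'
  have hAM'' : A' ⊓ LinearMap.ker (τ Z) ≤ M := inf_le_left.trans hAM'
  obtain ⟨W, hW⟩ := exists_regular τ (A' ⊓ LinearMap.ker (τ Z))
  have h1 := finrank_map_add_finrank_inf_ker (τ X) M
  have h2 := finrank_map_add_finrank_inf_ker (τ Y) A
  have h3 := finrank_map_add_finrank_inf_ker (τ Z) A'
  have h4 := h.finrank_add_le (L := Submodule.map₂ τ A ⊤) (L' := M.map (τ X))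
    fun v hv w hw => h.orthogonal_map₂ X hv hw
  have h5 := Submodule.finrank_mono (h.map_le_map₂ A Y)
  have g1 := h.finrank_map_inf_ker_le le_rfl hX Y
  have g2 := h.finrank_map_inf_ker_le hAM hY Z
  have g3 := h.finrank_map_inf_ker_le hAM' hZ W
  have p1 : finrank k A' ≠ 0 → 0 < finrank k (A'.map (τ Z)) := fun h0 =>
    h.finrank_map_pos hM hAM' (fun hbot => h0 (by rw [hbot, finrank_bot])) hZ
  have p2 : finrank k (A' ⊓ LinearMap.ker (τ Z) : Submodule k E) ≠ 0 →
      0 < finrank k ((A' ⊓ LinearMap.ker (τ Z)).map (τ W)) := fun h0 =>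
    h.finrank_map_pos hM hAM'' (fun hbot => h0 (by rw [hbot, finrank_bot])) hW
  rw [← hA] at h1 g1
  rw [← hA'] at h2 g2
  have hρ : finrank k (A.map (τ Y)) ≤ 3 := by
    rcases le_or_gt (finrank k (M.map (τ X))) 7 with hr | hr
    · exact g1.trans (greenBound_mono hr)
    · omega
  have g2' := g2.trans (greenBound_mono hρ)
  have hρ' : finrank k (A'.map (τ Z)) ≤ 1 := g2'
  have g3' := g3.trans (greenBound_mono hρ')
  rw [show greenBound 1 = 0 from rfl] at g3'
  have hρ3 : ¬ finrank k (A.map (τ Y)) ≤ 2 := fun hle => by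
    have h0 := g2.trans (greenBound_mono hle)
    rw [show greenBound 2 = 0 from rfl] at h0
    omega
  omega

/-- Two general vectors `X` and `Y` determine, up to a factor, a linear form `w` that vanishes at
both and whose cube belongs to `M`; its square `v` is a contraction of that cube. -/
theorem FlatOn.exists_cube (h : FlatOn b τ M) (hM : ∀ m ∈ M, τ m = 0 → m = 0)
    (hS : finrank k S ≤ 11) (hlt : finrank k S < finrank k M) {X Y : E} (hX : Regular τ M X)
    (hY : Regular τ (M ⊓ LinearMap.ker (τ X)) Y)
    (hYc : Regular (contract b τ) (Submodule.map₂ τ (M ⊓ LinearMap.ker (τ X)) ⊤) Y) :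
    ∃ (a : E) (w : Dual k E) (v : S) (μ : k), a ∈ M ∧ a ≠ 0 ∧ w X = 0 ∧ w Y = 0 ∧ μ ≠ 0 ∧
      (∀ e, τ a e = w e • v) ∧ ∀ c d, b v (τ c d) = μ * w c * w d := by
  obtain ⟨h1, h2⟩ := h.finrank_eq_of_lt hM hS hlt hX hY
  obtain ⟨a, ha, ha0⟩ := Submodule.exists_mem_ne_zero_of_ne_bot
    (Submodule.one_le_finrank_iff.1 h1.ge)
  have hN := h.finrank_inf_ker_contract_le hYc
  rw [h2] at hN
  have haX : τ X a = 0 := ha.1.2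
  have haY : τ Y a = 0 := ha.2
  have hτa : τ a ≠ 0 := fun h0 => ha0 (hM a ha.1.1 h0)
  obtain ⟨w, v, μ, hμ, hw, hb⟩ := h.exists_square ha.1.1 (N := _) hN (fun e =>
    ⟨Submodule.apply_mem_map₂ _ ha.1 trivial, by
      rw [h.symm]
      exact h.contract_eq_zero ha.1.1 haY e⟩) hτa
  have hv : v ≠ 0 := fun h0 => hτa <| LinearMap.ext fun e => by rw [hw, h0, smul_zero]; rfl
  refine ⟨a, w, v, μ, ha.1.1, ha0, ?_, ?_, hμ, hw, hb⟩
  · refine (smul_eq_zero.1 ?_).resolve_right hv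
    rw [← hw, h.symm, haX]
  · refine (smul_eq_zero.1 ?_).resolve_right hv
    rw [← hw, h.symm, haY]

/-- Points `x i` in general position: the linear form `w i j` attached to `x i` and `x j` vanishes at
no other of the points. That it does not vanish at `x l` means that no nonzero element of `M` is
killed by `x i`, `x j` and `x l`, a condition in which the order of the three points is
irrelevant. -/
theorem FlatOn.exists_general_points (h : FlatOn b τ M) (hM : ∀ m ∈ M, τ m = 0 → m = 0)
    (hS : finrank k S ≤ 11) (hlt : finrank k S < finrank k M) :
    ∃ (x : ℕ → E) (a : ℕ → ℕ → E) (w : ℕ → ℕ → Dual k E) (v : ℕ → ℕ → S) (μ : ℕ → ℕ → k),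
      ∀ i j, i < j → a i j ∈ M ∧ μ i j ≠ 0 ∧ w i j (x i) = 0 ∧ w i j (x j) = 0 ∧
        (∀ l, l ≠ i → l ≠ j → w i j (x l) ≠ 0) ∧
        (∀ e, τ (a i j) e = w i j e • v i j) ∧
        ∀ c d, b (v i j) (τ c d) = μ i j * w i j c * w i j d := by
  obtain ⟨x, hx⟩ := exists_seq_of_generic (k := k) (E := E)
    (P := fun s X => (Regular τ M X ∧ ∀ Y ∈ s, Regular τ (M ⊓ LinearMap.ker (τ Y)) X ∧
        Regular (contract b τ) (Submodule.map₂ τ (M ⊓ LinearMap.ker (τ Y)) ⊤) X) ∧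
      ∀ Y ∈ s, ∀ Z ∈ s, Regular τ (M ⊓ LinearMap.ker (τ Y) ⊓ LinearMap.ker (τ Z)) X)
    fun s => ((generic_regular _ _).and (Generic.forall_mem s fun Y _ =>
      (generic_regular _ _).and (generic_regular _ _))).and
        (Generic.forall_mem s fun Y _ => Generic.forall_mem s fun Z _ => generic_regular _ _)
  have hx1 : ∀ i, Regular τ M (x i) := fun i => by
    obtain ⟨s, -, hs⟩ := hx i
    exact hs.1.1
  have hx2 : ∀ i j, i < j → Regular τ (M ⊓ LinearMap.ker (τ (x i))) (x j) ∧
      Regular (contract b τ) (Submodule.map₂ τ (M ⊓ LinearMap.ker (τ (x i))) ⊤) (x j) :=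
    fun i j hij => by
      obtain ⟨s, hi, hs⟩ := hx j
      exact hs.1.2 _ (hi i hij)
  have hx3 : ∀ i j l, i < j → j < l → ∀ m ∈ M, τ m (x i) = 0 → τ m (x j) = 0 →
      τ m (x l) = 0 → m = 0 := fun i j l hij hjl m hm hmi hmj hml => by
    obtain ⟨s, hi, hs⟩ := hx l
    have hreg := hs.2 _ (hi i (hij.trans hjl)) _ (hi j hjl)
    have h1 := (h.finrank_eq_of_lt hM hS hlt (hx1 i) (hx2 i j hij).1).1
    have h2 := h.finrank_map_pos hM (inf_le_left.trans inf_le_left)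
      (Submodule.one_le_finrank_iff.1 h1.ge) hreg
    have h3 := finrank_map_add_finrank_inf_ker (τ (x l))
      (M ⊓ LinearMap.ker (τ (x i)) ⊓ LinearMap.ker (τ (x j)))
    have h4 : m ∈ M ⊓ LinearMap.ker (τ (x i)) ⊓ LinearMap.ker (τ (x j)) ⊓
        LinearMap.ker (τ (x l)) := by
      refine ⟨⟨⟨hm, ?_⟩, ?_⟩, ?_⟩
      · change τ (x i) m = 0
        rw [h.symm, hmi]
      · change τ (x j) m = 0
        rw [h.symm, hmj]
      · change τ (x l) m = 0
        rw [h.symm, hml]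
    rw [Submodule.finrank_eq_zero.1 (by omega : finrank k (M ⊓ LinearMap.ker (τ (x i)) ⊓
      LinearMap.ker (τ (x j)) ⊓ LinearMap.ker (τ (x l)) : Submodule k E) = 0)] at h4
    exact h4
  have key : ∀ i j, ∃ (a : E) (w : Dual k E) (v : S) (μ : k), i < j → a ∈ M ∧ μ ≠ 0 ∧
      w (x i) = 0 ∧ w (x j) = 0 ∧ (∀ l, l ≠ i → l ≠ j → w (x l) ≠ 0) ∧
        (∀ e, τ a e = w e • v) ∧ ∀ c d, b v (τ c d) = μ * w c * w d := fun i j => by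
    by_cases hij : i < j
    · obtain ⟨a, w, v, μ, ha, ha0, hwi, hwj, hμ, hw, hb⟩ :=
        h.exists_cube hM hS hlt (hx1 i) (hx2 i j hij).1 (hx2 i j hij).2
      refine ⟨a, w, v, μ, fun _ => ⟨ha, hμ, hwi, hwj, fun l hli hlj hl => ha0 ?_, hw, hb⟩⟩
      have h0 : ∀ {e}, w e = 0 → τ a e = 0 := fun {e} he => by rw [hw, he, zero_smul]
      rcases lt_or_gt_of_ne hli with hli | hli
      · exact hx3 l i j hli hij a ha (h0 hl) (h0 hwi) (h0 hwj)
      rcases lt_or_gt_of_ne hlj with hlj | hlj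
      · exact hx3 i l j hli hlj a ha (h0 hwi) (h0 hl) (h0 hwj)
      · exact hx3 i j l hij hlj a ha (h0 hwi) (h0 hwj) (h0 hl)
    · exact ⟨0, 0, 0, 0, fun h0 => absurd h0 hij⟩
  choose a w v μ hkey using key
  exact ⟨x, a, w, v, μ, hkey⟩

/-- Every pair `{p, q}` of indices among four has a complementary pair `{r, s}`, which meets all
the other pairs. -/
theorem exists_complementary_pair : ∀ p q : Fin 4, p < q → ∃ r s : Fin 4,
    (r ≠ p ∧ r ≠ q ∧ s ≠ p ∧ s ≠ q) ∧
      ∀ p' q' : Fin 4, p' < q' → (p', q') ≠ (p, q) → r = p' ∨ r = q' ∨ s = p' ∨ s = q' := by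
  decide

/-- Two disjoint sets of four general points would produce two six-dimensional subspaces of `S`
which are orthogonal to each other, which is impossible in dimension less than twelve. -/
theorem FlatOn.finrank_le_of_injective (h : FlatOn b τ M) (hM : ∀ m ∈ M, τ m = 0 → m = 0)
    (hS : finrank k S ≤ 11) : finrank k M ≤ finrank k S := by
  by_contra! hlt
  obtain ⟨x, a, w, v, μ, hx⟩ := h.exists_general_points hM hS hlt
  let ι := {p : Fin 4 × Fin 4 // p.1 < p.2}
  let u : ℕ → ι → S := fun n p => v (n + p.1.1) (n + p.1.2)
  have hcard : Fintype.card ι = 6 := by decide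
  -- The squares of the six lines through four general points of the plane are independent:
  -- polarizing at the two points off a line annihilates the squares of the other five.
  have hind : ∀ n, finrank k (Submodule.span k (Set.range (u n))) = 6 := fun n => by
    rw [finrank_span_eq_card, hcard]
    rw [Fintype.linearIndependent_iff]
    intro g hg p
    obtain ⟨r, s, ⟨hrp, hrq, hsp, hsq⟩, hpair⟩ := exists_complementary_pair p.1.1 p.1.2 p.2
    have hne : ∀ {i j : Fin 4}, i ≠ j → n + (i : ℕ) ≠ n + j := fun hij h0 =>
      hij (Fin.ext (by omega))
    have hlt' : ∀ q : ι, n + (q.1.1 : ℕ) < n + q.1.2 := fun q => by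
      have : (q.1.1 : ℕ) < q.1.2 := q.2
      omega
    have h0 := congrArg (fun y => b y (τ (x (n + r)) (x (n + s)))) hg
    simp only [map_sum, map_smul, LinearMap.sum_apply, LinearMap.smul_apply, map_zero,
      LinearMap.zero_apply] at h0
    rw [Finset.sum_eq_single p] at h0
    · obtain ⟨-, hμ, -, -, hl, -, hb⟩ := hx _ _ (hlt' p)
      simp only [u, hb, smul_eq_mul] at h0
      have hr := hl _ (hne hrp) (hne hrq)
      have hs := hl _ (hne hsp) (hne hsq)
      exact (mul_eq_zero.1 h0).resolve_right (mul_ne_zero (mul_ne_zero hμ hr) hs)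
    · intro q _ hqp
      obtain ⟨-, -, hi, hj, -, -, hb⟩ := hx _ _ (hlt' q)
      have hq := hpair q.1.1 q.1.2 q.2 fun h0 => hqp (Subtype.ext h0)
      simp only [u, hb]
      rcases hq with rfl | rfl | rfl | rfl
      · simp [hi]
      · simp [hj]
      · simp [hi]
      · simp [hj]
    · simp
  -- The squares of two lines are orthogonal, as each line misses a point of the other.
  have horth : ∀ p q : ι, b (u 0 p) (u 4 q) = 0 := fun p q => by
    have hp : (p.1.1 : ℕ) < p.1.2 := p.2
    have hq : (q.1.1 : ℕ) < q.1.2 := q.2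
    have h3 := p.1.2.2
    obtain ⟨ha, -, hi, -, hl, hτ, -⟩ := hx (0 + p.1.1) (0 + p.1.2) (by omega)
    obtain ⟨-, -, hi', -, hl', hτ', -⟩ := hx (4 + q.1.1) (4 + q.1.2) (by omega)
    have h1 := hl (4 + q.1.1) (by omega) (by omega)
    have h2 := hl' (0 + p.1.1) (by omega) (by omega)
    have hflat := h.flat _ ha (x (4 + q.1.1)) (a (4 + q.1.1) (4 + q.1.2)) (x (0 + p.1.1))
    rw [h.symm (x (4 + q.1.1)), ← h.flat _ ha (x (0 + p.1.1)), hτ, hτ', hτ, hi, zero_smul,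
      map_zero, LinearMap.zero_apply, map_smul, map_smul, LinearMap.smul_apply, smul_smul,
      smul_eq_mul] at hflat
    exact (mul_eq_zero.1 hflat).resolve_left (mul_ne_zero h2 h1)
  have hsum := h.finrank_add_le (L := Submodule.span k (Set.range (u 0)))
    (L' := Submodule.span k (Set.range (u 4))) fun y hy z hz => by
      have h1 : Submodule.span k (Set.range (u 4)) ≤ LinearMap.ker (b y) := by
        rw [Submodule.span_le]
        rintro _ ⟨q, rfl⟩
        have h2 : Submodule.span k (Set.range (u 0)) ≤ LinearMap.ker (b.flip (u 4 q)) := by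
          rw [Submodule.span_le]
          rintro _ ⟨p, rfl⟩
          exact horth p q
        exact h2 hy
      exact h1 hz
  rw [hind, hind] at hsum
  omega

theorem FlatOn.finrank_le (h : FlatOn b τ M) (hS : finrank k S ≤ 11) :
    finrank k M ≤ finrank k S + finrank k (M ⊓ LinearMap.ker τ : Submodule k E) := by
  obtain ⟨C, hC⟩ := Submodule.exists_isCompl (M ⊓ LinearMap.ker τ)
  have hM' : FlatOn b τ (M ⊓ C) := ⟨h.comm, h.symm, fun m hm => h.flat m hm.1, h.separating⟩
  have h1 := hM'.finrank_le_of_injective (fun m hm hm0 => by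
    have : m ∈ (M ⊓ LinearMap.ker τ) ⊓ C := ⟨⟨hm.1, hm0⟩, hm.2⟩
    rwa [hC.inf_eq_bot] at this) hS
  have h2 : M ≤ (M ⊓ LinearMap.ker τ) ⊔ (M ⊓ C) := by
    rw [inf_comm M C, ← sup_inf_assoc_of_le C inf_le_left, hC.sup_eq_top, top_inf_eq]
  have h3 := Submodule.finrank_mono h2
  have h4 := Submodule.finrank_add_le_finrank_add_finrank (M ⊓ LinearMap.ker τ) (M ⊓ C)
  omega

end Bound

/-! ### Complex linear flat forms -/

section Projection

variable {k E W : Type*} [Field k] [Infinite k] [AddCommGroup E] [Module k E] [AddCommGroup W]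
  [Module k W] [FiniteDimensional k E]

/-- The bound for a symmetric bilinear form `s` whose restriction to `M × E` takes values in a
nondegenerate subspace `S`; it is obtained by projecting `s` to `S`. -/
theorem finrank_le_of_flat_of_mem {b : LinearMap.BilinForm k W} {s : E →ₗ[k] E →ₗ[k] W}
    {M : Submodule k E} {S : Submodule k W} [FiniteDimensional k S]
    (hb : ∀ v w, b v w = b w v) (hs : ∀ a c, s a c = s c a)
    (hflat : ∀ m ∈ M, ∀ a c d, b (s m a) (s c d) = b (s m c) (s a d))
    (hnd : ∀ v ∈ S, (∀ w ∈ S, b v w = 0) → v = 0)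
    (hmem : ∀ m ∈ M, ∀ a, s m a ∈ S)
    (hsep : ∀ v ∈ S, (∀ a c, b v (s a c) = 0) → v = 0) (hS : finrank k S ≤ 11) :
    finrank k M ≤ finrank k S + finrank k (M ⊓ LinearMap.ker s : Submodule k E) := by
  let b' : LinearMap.BilinForm k S := b.restrict S
  have hb' : ∀ v w : S, b' v w = b v w := fun _ _ => rfl
  have hinj : Function.Injective b' := by
    rw [← LinearMap.ker_eq_bot, eq_bot_iff]
    intro v hv
    refine Subtype.ext (hnd v v.2 fun w hw => ?_)
    exact LinearMap.congr_fun (show b' v = 0 from hv) ⟨w, hw⟩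
  let e : S ≃ₗ[k] Dual k S :=
    LinearEquiv.ofInjectiveOfFinrankEq b' hinj (Subspace.dual_finrank_eq).symm
  have he : ∀ v w : S, e v w = b v w := fun _ _ => rfl
  let τ : E →ₗ[k] E →ₗ[k] S := s.compr₂ (e.symm.toLinearMap ∘ₗ S.subtype.dualMap ∘ₗ b)
  have hτ : ∀ a c (v : S), b (τ a c) v = b (s a c) v := fun a c v => by
    rw [← he]
    simp [τ]
  have hτM : ∀ m ∈ M, ∀ a, (τ m a : W) = s m a := fun m hm a => by
    have : τ m a = ⟨s m a, hmem m hm a⟩ := hinj <| LinearMap.ext fun v => hτ m a v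
    rw [this]
  have h : FlatOn b' τ M := by
    refine ⟨fun v w => hb _ _, fun a c => ?_, fun m hm a c d => ?_, fun v hv => ?_⟩
    · simp only [τ, LinearMap.compr₂_apply, hs a c]
    · rw [hb', hb', hb, hτ, hτM m hm, hb _ (τ a d : W), hτ, hτM m hm, hb, hflat m hm, hb]
    · refine Subtype.ext (hsep v v.2 fun a c => ?_)
      rw [hb, ← hτ, hb]
      exact hv a c
  refine (h.finrank_le hS).trans (Nat.add_le_add_left (Submodule.finrank_mono ?_) _)
  rintro m ⟨hm, hm0⟩
  refine ⟨hm, LinearMap.ext fun a => ?_⟩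
  rw [← hτM m hm, show τ m = 0 from hm0]
  rfl

end Projection

section Image

variable {V₁ V₂ W : Type*} [AddCommGroup V₁] [Module ℝ V₁] [AddCommGroup V₂] [Module ℝ V₂]
  [AddCommGroup W] [Module ℝ W]

theorem apply_mem_image (φ : V₁ →ₗ[ℝ] V₂ →ₗ[ℝ] W) (X : V₁) (Y : V₂) : φ X Y ∈ image φ :=
  Submodule.subset_span ⟨X, Y, rfl⟩

theorem mem_orthogonal_image {B : LinearMap.BilinForm ℝ W} {φ : V₁ →ₗ[ℝ] V₂ →ₗ[ℝ] W} {w : W} :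
    w ∈ B.orthogonal (image φ) ↔ ∀ X Y, B (φ X Y) w = 0 := by
  refine ⟨fun h X Y => h _ (apply_mem_image φ X Y), fun h v hv => ?_⟩
  have hle : image φ ≤ LinearMap.ker (B.flip w) := by
    refine Submodule.span_le.2 ?_
    rintro _ ⟨X, Y, rfl⟩
    exact h X Y
  exact hle hv

end Image

section Complex

variable {V : Type*} [AddCommGroup V] [Module ℝ V] [Module ℂ V]
  {W : Type*} [AddCommGroup W] [Module ℝ W] [Module ℂ W]
  {B : LinearMap.BilinForm ℝ W} {γ β : V →ₗ[ℝ] V →ₗ[ℝ] W}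

/-- Flatness of `γ` already implies the mixed flatness of `β` and `γ`, because `γ` is complex linear
in its second argument. -/
theorem pairing_add_conj_comm (hBI : ∀ v w, B (Complex.I • v) w = B v (Complex.I • w))
    (hγI : ∀ X Y, γ X (Complex.I • Y) = Complex.I • γ X Y)
    (hβ : ∀ X Y, β X Y = γ X Y + γ (Complex.I • X) (Complex.I • Y)) (hγ : IsFlat B γ)
    (X Y Z T : V) : B (β X Y) (γ Z T) = B (β X T) (γ Z Y) := by
  have h1 := hγ X Z Y T
  have h2 := hγ (Complex.I • X) Z (Complex.I • Y) T
  rw [hγI Z Y, ← hBI, ← hγI] at h2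
  rw [hβ, hβ, map_add, map_add, LinearMap.add_apply, LinearMap.add_apply]
  linarith

theorem isFlat_add_conj (hBI : ∀ v w, B (Complex.I • v) w = B v (Complex.I • w))
    (hγI : ∀ X Y, γ X (Complex.I • Y) = Complex.I • γ X Y)
    (hβ : ∀ X Y, β X Y = γ X Y + γ (Complex.I • X) (Complex.I • Y)) (hγ : IsFlat B γ) :
    IsFlat B β := by
  intro X Z Y T
  have hβI : ∀ X Y, β X (Complex.I • Y) = Complex.I • β X Y := fun X Y => by
    rw [hβ, hβ, hγI, hγI _ (Complex.I • Y), smul_add]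
  have h1 := pairing_add_conj_comm hBI hγI hβ hγ X Y Z T
  have h2 := pairing_add_conj_comm hBI hγI hβ hγ X Y (Complex.I • Z) (Complex.I • T)
  rw [hβI, hBI, ← hγI] at h2
  rw [hβ Z T, hβ Z Y, map_add, map_add]
  linarith

variable [IsScalarTower ℝ ℂ W]

theorem I_smul_mem_image {φ : V →ₗ[ℝ] V →ₗ[ℝ] W}
    (hφ : ∀ X Y, φ X (Complex.I • Y) = Complex.I • φ X Y) {w : W} (hw : w ∈ image φ) :
    Complex.I • w ∈ image φ := by
  induction hw using Submodule.span_induction with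
  | mem w hw =>
    obtain ⟨X, Y, rfl⟩ := hw
    exact Submodule.subset_span ⟨X, Complex.I • Y, hφ X Y⟩
  | zero => simp
  | add v w _ _ hv hw => rw [smul_add]; exact add_mem hv hw
  | smul r w _ hw => rw [smul_comm]; exact Submodule.smul_mem _ _ hw

variable [IsScalarTower ℝ ℂ V]

theorem complex_smul_eq (z : ℂ) (v : V) : z • v = z.re • v + z.im • Complex.I • v := by
  conv_lhs => rw [← Complex.re_add_im z]
  rw [add_smul, mul_smul, ← Complex.coe_algebraMap, algebraMap_smul, algebraMap_smul]

/-- A real subspace stable under multiplication by `I`, as a complex subspace. -/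
def complexSubmodule (L : Submodule ℝ V) (hL : ∀ v ∈ L, Complex.I • v ∈ L) : Submodule ℂ V where
  carrier := L
  add_mem' := L.add_mem
  zero_mem' := L.zero_mem
  smul_mem' z v hv := by
    rw [complex_smul_eq]
    exact L.add_mem (L.smul_mem _ hv) (L.smul_mem _ (hL v hv))

theorem finrank_complexSubmodule (L : Submodule ℝ V) (hL : ∀ v ∈ L, Complex.I • v ∈ L) :
    2 * finrank ℂ (complexSubmodule L hL) = finrank ℝ L := by
  rw [← Complex.finrank_real_complex, Module.finrank_mul_finrank ℝ ℂ]
  rfl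

/-- The complex bilinear form whose real part is a given real bilinear form for which
multiplication by `I` is self-adjoint. -/
def complexForm (B : LinearMap.BilinForm ℝ W)
    (hBI : ∀ v w, B (Complex.I • v) w = B v (Complex.I • w)) : LinearMap.BilinForm ℂ W :=
  have hII : ∀ v : W, Complex.I • Complex.I • v = -v := fun v => by
    rw [smul_smul, Complex.I_mul_I, neg_one_smul]
  LinearMap.mk₂ ℂ (fun v w => (B v w : ℂ) - Complex.I * B (Complex.I • v) w)
    (fun v v' w => by simp only [smul_add, map_add, LinearMap.add_apply]; push_cast; ring)
    (fun z v w => by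
      rw [complex_smul_eq z v]
      simp only [smul_add, map_add, LinearMap.add_apply, map_smul, LinearMap.smul_apply,
        smul_comm Complex.I (_ : ℝ), hII, map_neg, LinearMap.neg_apply, smul_eq_mul]
      conv_rhs => rw [← Complex.re_add_im z]
      push_cast
      linear_combination ((z.im : ℂ) * B (Complex.I • v) w) * Complex.I_mul_I)
    (fun v w w' => by simp only [map_add]; push_cast; ring)
    (fun z v w => by
      rw [complex_smul_eq z w]
      simp only [map_add, map_smul, ← hBI, hII, map_neg, LinearMap.neg_apply, smul_eq_mul]
      conv_rhs => rw [← Complex.re_add_im z]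
      push_cast
      linear_combination ((z.im : ℂ) * B (Complex.I • v) w) * Complex.I_mul_I)

theorem complexForm_apply (hBI : ∀ v w, B (Complex.I • v) w = B v (Complex.I • w)) (v w : W) :
    complexForm B hBI v w = (B v w : ℂ) - Complex.I * B (Complex.I • v) w := rfl

theorem complexForm_re (hBI : ∀ v w, B (Complex.I • v) w = B v (Complex.I • w)) (v w : W) :
    (complexForm B hBI v w).re = B v w := by
  simp [complexForm_apply]

/-- The complex bilinear part `γ(X, Y) - γ(IX, IY)` of a form which is complex linear in its second
argument. -/
def complexPart (γ : V →ₗ[ℝ] V →ₗ[ℝ] W)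
    (hγI : ∀ X Y, γ X (Complex.I • Y) = Complex.I • γ X Y) : V →ₗ[ℂ] V →ₗ[ℂ] W :=
  have hII : ∀ v : V, Complex.I • Complex.I • v = -v := fun v => by
    rw [smul_smul, Complex.I_mul_I, neg_one_smul]
  have hIW : ∀ v : W, Complex.I • Complex.I • v = -v := fun v => by
    rw [smul_smul, Complex.I_mul_I, neg_one_smul]
  LinearMap.mk₂ ℂ (fun X Y => γ X Y - γ (Complex.I • X) (Complex.I • Y))
    (fun X X' Y => by simp only [smul_add, map_add, LinearMap.add_apply]; abel)
    (fun z X Y => by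
      rw [complex_smul_eq z X, complex_smul_eq z (_ - _)]
      simp only [smul_add, map_add, LinearMap.add_apply, map_smul, LinearMap.smul_apply,
        smul_comm Complex.I (_ : ℝ), hII, hIW, map_neg, LinearMap.neg_apply, hγI, smul_sub,
        smul_neg]
      abel)
    (fun X Y Y' => by simp only [smul_add, map_add]; abel)
    (fun z X Y => by
      rw [complex_smul_eq z Y, complex_smul_eq z (_ - _)]
      simp only [smul_add, map_add, map_smul, hγI, smul_sub, smul_comm Complex.I (_ : ℝ)]
      abel)

theorem complexPart_apply (hγI : ∀ X Y, γ X (Complex.I • Y) = Complex.I • γ X Y) (X Y : V) :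
    complexPart γ hγI X Y = γ X Y - γ (Complex.I • X) (Complex.I • Y) := rfl

variable [FiniteDimensional ℝ V] [FiniteDimensional ℝ W]

/-- The nullity estimate in terms of complex structures. On `M = N(β)` only the complex bilinear
part `s` of `γ` is left; it takes values in `S(γ) ∩ S(β)^⊥` there, so that the estimate for
complex flat forms applies to it. -/
theorem finrank_le_of_not_isDegenerate (hB : ∀ v w, B v w = B w v)
    (hBI : ∀ v w, B (Complex.I • v) w = B v (Complex.I • w))
    (hγI : ∀ X Y, γ X (Complex.I • Y) = Complex.I • γ X Y)
    (hβ : ∀ X Y, β X Y = γ X Y + γ (Complex.I • X) (Complex.I • Y)) (hγ : IsFlat B γ)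
    (hs : ∀ X Y, γ X Y - γ (Complex.I • X) (Complex.I • Y) =
      γ Y X - γ (Complex.I • Y) (Complex.I • X))
    (hW : finrank ℝ W ≤ 22) (hγnd : ¬ IsDegenerate B (image γ))
    (hβnd : ¬ IsDegenerate B (image β)) (hβν : finrank ℝ V ≤ nu β + finrank ℝ (image β)) :
    finrank ℝ V ≤ nu γ + finrank ℝ (image γ) := by
  have : FiniteDimensional ℂ V := Module.Finite.of_restrictScalars_finite ℝ ℂ V
  have : FiniteDimensional ℂ W := Module.Finite.of_restrictScalars_finite ℝ ℂ W
  rw [IsDegenerate, not_not] at hγnd hβnd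
  have hβI : ∀ X Y, β X (Complex.I • Y) = Complex.I • β X Y := fun X Y => by
    rw [hβ, hβ, hγI, hγI _ (Complex.I • Y), smul_add]
  have hβγ : image β ≤ image γ := by
    refine Submodule.span_le.2 ?_
    rintro _ ⟨X, Y, rfl⟩
    rw [hβ]
    exact add_mem (apply_mem_image _ _ _) (apply_mem_image _ _ _)
  have horthI : ∀ w ∈ B.orthogonal (image β), Complex.I • w ∈ B.orthogonal (image β) :=
    fun w hw => mem_orthogonal_image.2 fun X Y => by
      rw [← hBI, ← hβI]
      exact mem_orthogonal_image.1 hw _ _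
  let S := complexSubmodule (image γ ⊓ B.orthogonal (image β))
    fun w hw => ⟨I_smul_mem_image hγI hw.1, horthI w hw.2⟩
  have hSdim : 2 * finrank ℂ S = finrank ℝ (image γ ⊓ B.orthogonal (image β) : Submodule ℝ W) :=
    finrank_complexSubmodule _ _
  let M := complexSubmodule (nullity β) fun Y hY X => by rw [hβI, hY X, smul_zero]
  have hM : ∀ m ∈ M, ∀ X, β X m = 0 := fun m hm => hm
  let s := complexPart γ hγI
  let b := complexForm B hBI
  have hsM : ∀ m ∈ M, ∀ a, s m a = (2 : ℝ) • γ a m := fun m hm a => by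
    have h1 := hM m hm a
    rw [hβ] at h1
    rw [complexPart_apply, hs, two_smul, eq_neg_of_add_eq_zero_right h1, sub_neg_eq_add]
  have hmixed := pairing_add_conj_comm hBI hγI hβ hγ
  have hrefl : B.IsRefl := fun v w h => by rw [hB, h]
  have hcompl : IsCompl (image β) (B.orthogonal (image β)) :=
    (LinearMap.BilinForm.isCompl_orthogonal_iff_disjoint hrefl).2 (disjoint_iff.2 hβnd)
  have hflatre : ∀ m ∈ M, ∀ a c d, B (s m a) (s c d) = B (s m c) (s a d) := by
    have hhalf : ∀ m ∈ M, ∀ a c d, B (γ a m) (s c d) = 2 * B (γ a d) (γ c m) :=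
      fun m hm a c d => by
        have h1 := hγ a c m d
        have h2 := hγ a (Complex.I • c) m (Complex.I • d)
        have h3 := hM m hm c
        rw [hβ] at h3
        rw [hγI a d, hBI, ← hγI, eq_neg_of_add_eq_zero_right h3, map_neg] at h2
        rw [complexPart_apply, map_sub]
        linarith
    intro m hm a c d
    have h1 := hγ a c d m
    rw [hsM m hm, hsM m hm, map_smul, map_smul, LinearMap.smul_apply, LinearMap.smul_apply,
      hhalf m hm, hhalf m hm, hB (γ c d)]
    have h2 := hB (γ a m) (γ c d)
    rw [show B (γ a d) (γ c m) = B (γ a m) (γ c d) by linarith]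
  have key := finrank_le_of_flat_of_mem (b := b) (s := s) (M := M) (S := S)
    (fun v w => by rw [complexForm_apply, complexForm_apply, hB v w, hBI, hB v])
    (fun a c => hs a c)
    (fun m hm a c d => by
      rw [complexForm_apply, complexForm_apply, hflatre m hm a c d, ← map_smul,
        hflatre m hm (Complex.I • a) c d, map_smul, LinearMap.smul_apply, ← hBI])
    (fun v hv h => by
      have h1 : v ∈ image γ ⊓ B.orthogonal (image γ) := by
        refine ⟨hv.1, fun w hw => ?_⟩
        have hw' : w ∈ image β ⊔ image γ ⊓ B.orthogonal (image β) := by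
          rw [inf_comm, ← sup_inf_assoc_of_le _ hβγ, hcompl.sup_eq_top, top_inf_eq]
          exact hw
        obtain ⟨x, hx, y, hy, rfl⟩ := Submodule.mem_sup.1 hw'
        have h2 : B x v = 0 := hv.2 x hx
        have h3 := congrArg Complex.re (h y hy)
        rw [complexForm_re, Complex.zero_re] at h3
        change B (x + y) v = 0
        rw [map_add, LinearMap.add_apply, h2, hB, h3, add_zero]
      rwa [hγnd] at h1)
    (fun m hm a => ⟨sub_mem (apply_mem_image _ _ _) (apply_mem_image _ _ _),
      mem_orthogonal_image.2 fun X Y => by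
        rw [hsM m hm, map_smul, hmixed, hM m hm, map_zero, LinearMap.zero_apply, smul_zero]⟩)
    (fun v hv h => by
      have h1 : v ∈ image γ ⊓ B.orthogonal (image γ) := by
        refine ⟨hv.1, mem_orthogonal_image.2 fun X Y => ?_⟩
        have h2 := congrArg Complex.re (h X Y)
        have h3 := mem_orthogonal_image.1 hv.2 X Y
        rw [complexForm_re, Complex.zero_re, complexPart_apply, map_sub] at h2
        rw [hB, hβ, map_add] at h3
        rw [hB]
        linarith
      rwa [hγnd] at h1)
    (by
      have h1 := Submodule.finrank_le (image γ ⊓ B.orthogonal (image β))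
      omega)
  have hS : finrank ℝ (image β) + 2 * finrank ℂ S ≤ finrank ℝ (image γ) := by
    rw [hSdim]
    have h1 := Submodule.finrank_sup_add_finrank_inf_eq (image β)
      (image γ ⊓ B.orthogonal (image β))
    have h2 : image β ⊓ (image γ ⊓ B.orthogonal (image β)) = ⊥ := by
      rw [inf_left_comm, hβnd, inf_bot_eq]
    have h3 := Submodule.finrank_mono (sup_le hβγ inf_le_left :
      image β ⊔ image γ ⊓ B.orthogonal (image β) ≤ image γ)
    rw [h2, finrank_bot] at h1
    omega
  have hMν : 2 * finrank ℂ M = nu β := finrank_complexSubmodule _ _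
  have hK : 2 * finrank ℂ (M ⊓ LinearMap.ker s : Submodule ℂ V) ≤ nu γ := by
    rw [← Complex.finrank_real_complex, Module.finrank_mul_finrank ℝ ℂ]
    refine Submodule.finrank_mono
      (s := (M ⊓ LinearMap.ker s : Submodule ℂ V).restrictScalars ℝ) (t := nullity γ) ?_
    rintro m ⟨hm, hm0⟩ a
    have h1 := hsM m hm a
    rw [show s m = 0 from hm0, LinearMap.zero_apply] at h1
    exact (smul_eq_zero.1 h1.symm).resolve_left two_ne_zero
  omega

end Complex

/-! ### The forms `β` and `γ`, and the radical of `S(γ)` -/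

section ComplexStructure

variable {V : Type*} [AddCommGroup V] [Module ℝ V]

/-- The complex vector space defined by a complex structure. -/
abbrev complexModule (J : V →ₗ[ℝ] V) (hJ : ∀ X, J (J X) = -X) : Module ℂ V :=
  Module.compHom V (Complex.lift (A := Module.End ℝ V)
    ⟨J, LinearMap.ext hJ⟩).toRingHom

theorem complexModule_I_smul (J : V →ₗ[ℝ] V) (hJ : ∀ X, J (J X) = -X) (X : V) :
    letI := complexModule J hJ
    Complex.I • X = J X :=
  LinearMap.congr_fun (Complex.liftAux_apply_I (A := Module.End ℝ V) J (LinearMap.ext hJ)) X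

theorem complexModule_isScalarTower (J : V →ₗ[ℝ] V) (hJ : ∀ X, J (J X) = -X) :
    letI := complexModule J hJ
    IsScalarTower ℝ ℂ V :=
  letI := complexModule J hJ
  ⟨fun r z X => LinearMap.congr_fun (map_smul (Complex.lift (A := Module.End ℝ V)
    ⟨J, LinearMap.ext hJ⟩) r z) X⟩

end ComplexStructure

section Pairing

variable {U : Type*} [NormedAddCommGroup U] [InnerProductSpace ℝ U]

theorem pairing_comm (v w : U × U) : pairing U v w = pairing U w v := by
  rw [pairing_apply, pairing_apply, real_inner_comm, real_inner_comm w.2]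

/-- Multiplication by the imaginary unit on `U ⊕ U`. It is chosen so that
`γ(X, JY)` is the image of `γ(X, Y)`. -/
def rotate (U : Type*) [AddCommGroup U] [Module ℝ U] : U × U →ₗ[ℝ] U × U :=
  (LinearMap.snd ℝ U U).prod (-LinearMap.fst ℝ U U)

theorem rotate_apply (v : U × U) : rotate U v = (v.2, -v.1) := rfl

theorem rotate_rotate (v : U × U) : rotate U (rotate U v) = -v := rfl

theorem pairing_rotate (v w : U × U) :
    pairing U (rotate U v) w = pairing U v (rotate U w) := by
  simp only [pairing_apply, rotate_apply, inner_neg_left, inner_neg_right]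
  ring

variable {V : Type*} [AddCommGroup V] [Module ℝ V]

/-- The hermitian symmetry of `β` turns flatness into `⟪β(X, X)₁, β(Y, Y)₁⟫ = ‖β(X, Y)‖²`. -/
theorem pairing_self_of_hermitian {β : V →ₗ[ℝ] V →ₗ[ℝ] U × U} (hβ : IsFlat (pairing U) β)
    (h1 : ∀ X Y, (β X Y).1 = (β Y X).1) (h2 : ∀ X Y, (β X Y).2 = -(β Y X).2) (X Y : V) :
    pairing U (β X X) (β Y Y) = ‖(β X Y).1‖ ^ 2 + ‖(β X Y).2‖ ^ 2 := by
  rw [sub_eq_zero.1 (hβ X Y X Y), pairing_apply, ← h1 X Y, h2 Y X, inner_neg_right,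
    real_inner_self_eq_norm_sq, real_inner_self_eq_norm_sq]
  ring

theorem eq_zero_of_hermitian {β : V →ₗ[ℝ] V →ₗ[ℝ] U × U} (hβ : IsFlat (pairing U) β)
    (h1 : ∀ X Y, (β X Y).1 = (β Y X).1) (h2 : ∀ X Y, (β X Y).2 = -(β Y X).2) {X Y : V}
    (h : pairing U (β X X) (β Y Y) = 0) : β X Y = 0 := by
  rw [pairing_self_of_hermitian hβ h1 h2] at h
  have ha := sq_nonneg ‖(β X Y).1‖
  have hb := sq_nonneg ‖(β X Y).2‖
  exact Prod.ext (norm_eq_zero.1 (pow_eq_zero_iff two_ne_zero |>.1 (by linarith)))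
    (norm_eq_zero.1 (pow_eq_zero_iff two_ne_zero |>.1 (by linarith)))

theorem gamma_apply_J {J : V →ₗ[ℝ] V} (hJ : ∀ X, J (J X) = -X) (α : V →ₗ[ℝ] V →ₗ[ℝ] U)
    (X Y : V) : gamma J α X (J Y) = rotate U (gamma J α X Y) := by
  rw [gamma_apply, gamma_apply, hJ, map_neg, rotate_apply]

variable [FiniteDimensional ℝ V]

/-- A vector `X` for which `ker β(X, ·)` has minimal dimension satisfies `ker β(X, ·) = N(β)`:
for `Y` in the kernel, positivity gives `ker β(X + Y, ·) = ker β(X, ·) ∩ ker β(Y, ·)`, so that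
`β(Y, Y) = 0` by minimality. -/
theorem finrank_le_of_hermitian [FiniteDimensional ℝ U] {β : V →ₗ[ℝ] V →ₗ[ℝ] U × U}
    (hβ : IsFlat (pairing U) β) (h1 : ∀ X Y, (β X Y).1 = (β Y X).1)
    (h2 : ∀ X Y, (β X Y).2 = -(β Y X).2) : finrank ℝ V ≤ nu β + finrank ℝ (image β) := by
  have hcomm : ∀ {X Y}, β X Y = 0 → β Y X = 0 := fun {X Y} h =>
    Prod.ext (by rw [h1, h]) (by rw [h2, h]; exact neg_zero)
  obtain ⟨X, hX⟩ : ∃ X, ∀ Y, finrank ℝ (LinearMap.ker (β X)) ≤ finrank ℝ (LinearMap.ker (β Y)) :=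
    ⟨Function.argmin fun X => finrank ℝ (LinearMap.ker (β X)),
      fun Y => Function.argmin_le (fun X => finrank ℝ (LinearMap.ker (β X))) Y⟩
  have hpos : ∀ X Y, 0 ≤ pairing U (β X X) (β Y Y) := fun X Y => by
    rw [pairing_self_of_hermitian hβ h1 h2]
    positivity
  have hker : LinearMap.ker (β X) ≤ nullity β := by
    intro Y hY Z
    have hXY : β X Y = 0 := hY
    have hsum : β (X + Y) (X + Y) = β X X + β Y Y := by
      simp [hXY, hcomm hXY]
    have hle : LinearMap.ker (β (X + Y)) ≤ LinearMap.ker (β X) ⊓ LinearMap.ker (β Y) := by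
      intro T hT
      have h3 : pairing U (β (X + Y) (X + Y)) (β T T) = 0 := by
        rw [pairing_self_of_hermitian hβ h1 h2, show β (X + Y) T = 0 from hT]
        simp
      rw [hsum, map_add, LinearMap.add_apply] at h3
      have h4 := hpos X T
      have h5 := hpos Y T
      exact ⟨eq_zero_of_hermitian hβ h1 h2 (by linarith),
        eq_zero_of_hermitian hβ h1 h2 (by linarith)⟩
    have heq := Submodule.eq_of_le_of_finrank_le (hle.trans inf_le_left) (hX (X + Y))
    have hYY : β Y Y = 0 := by
      have : Y ∈ LinearMap.ker (β (X + Y)) := heq ▸ hY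
      exact (hle this).2
    exact eq_zero_of_hermitian hβ h1 h2 (by rw [hYY, map_zero])
  have h3 := LinearMap.finrank_range_add_finrank_ker (β X)
  have h4 := Submodule.finrank_mono hker
  have h5 : finrank ℝ (LinearMap.range (β X)) ≤ finrank ℝ (image β) :=
    Submodule.finrank_mono (by rintro _ ⟨Y, rfl⟩; exact apply_mem_image β X Y)
  rw [nu]
  omega

theorem not_isDegenerate_of_hermitian {V : Type*} [AddCommGroup V] [Module ℝ V]
    {β : V →ₗ[ℝ] V →ₗ[ℝ] U × U} (h1 : ∀ X Y, (β X Y).1 = (β Y X).1)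
    (h2 : ∀ X Y, (β X Y).2 = -(β Y X).2) : ¬ IsDegenerate (pairing U) (image β) := by
  rw [IsDegenerate, not_not, eq_bot_iff]
  rintro v ⟨hv, hv'⟩
  -- The image is stable under conjugation, and `v` pairs with its conjugate to `‖v₁‖² + ‖v₂‖²`.
  have hconj : ∀ w ∈ image β, (w.1, -w.2) ∈ image β := by
    intro w hw
    have hle : image β ≤ (image β).comap (LinearMap.prodMap LinearMap.id (-LinearMap.id)) := by
      refine Submodule.span_le.2 ?_
      rintro _ ⟨X, Y, rfl⟩
      change ((β X Y).1, -(β X Y).2) ∈ image β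
      rw [h1, h2 X Y, neg_neg]
      exact apply_mem_image β Y X
    exact hle hw
  have h := hv' _ (hconj v hv)
  change pairing U (v.1, -v.2) v = 0 at h
  rw [pairing_apply, inner_neg_left, real_inner_self_eq_norm_sq, real_inner_self_eq_norm_sq] at h
  have ha := sq_nonneg ‖v.1‖
  have hb := sq_nonneg ‖v.2‖
  exact Prod.ext (norm_eq_zero.1 (pow_eq_zero_iff two_ne_zero |>.1 (by linarith)))
    (norm_eq_zero.1 (pow_eq_zero_iff two_ne_zero |>.1 (by linarith)))

/-- The nullity estimate for a flat form `γ` with nondegenerate image. -/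
theorem finrank_le_nu_gamma_add [FiniteDimensional ℝ U] (hU : finrank ℝ U ≤ 11)
    {J : V →ₗ[ℝ] V} (hJ : ∀ X, J (J X) = -X) {α : V →ₗ[ℝ] V →ₗ[ℝ] U}
    (hα : ∀ X Y, α X Y = α Y X) (hγ : IsFlat (pairing U) (gamma J α))
    (hnd : ¬ IsDegenerate (pairing U) (image (gamma J α))) :
    finrank ℝ V ≤ nu (gamma J α) + finrank ℝ (image (gamma J α)) := by
  let _ := complexModule J hJ
  let _ := complexModule (rotate U) rotate_rotate
  have : IsScalarTower ℝ ℂ V := complexModule_isScalarTower J hJ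
  have : IsScalarTower ℝ ℂ (U × U) := complexModule_isScalarTower (rotate U) rotate_rotate
  have hIV : ∀ X : V, Complex.I • X = J X := complexModule_I_smul J hJ
  have hIW : ∀ w : U × U, Complex.I • w = rotate U w :=
    complexModule_I_smul (rotate U) rotate_rotate
  have hBI : ∀ v w : U × U, pairing U (Complex.I • v) w = pairing U v (Complex.I • w) :=
    fun v w => by rw [hIW, hIW, pairing_rotate]
  have hγI : ∀ X Y, gamma J α X (Complex.I • Y) = Complex.I • gamma J α X Y :=
    fun X Y => by rw [hIV, hIW, gamma_apply_J hJ]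
  have hβ : ∀ X Y, beta J α X Y = gamma J α X Y + gamma J α (Complex.I • X) (Complex.I • Y) :=
    fun X Y => by rw [hIV, hIV, beta_apply]
  have h1 : ∀ X Y, (beta J α X Y).1 = (beta J α Y X).1 := fun X Y => by
    simp only [beta_apply, gamma_apply, Prod.fst_add]
    rw [hα X Y, hα (J X)]
  have h2 : ∀ X Y, (beta J α X Y).2 = -(beta J α Y X).2 := fun X Y => by
    simp only [beta_apply, gamma_apply, Prod.snd_add, hJ, map_neg]
    rw [hα X (J Y), hα (J X) Y]
    abel
  refine finrank_le_of_not_isDegenerate pairing_comm hBI hγI hβ hγ (fun X Y => ?_) ?_ hnd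
    (not_isDegenerate_of_hermitian h1 h2)
    (finrank_le_of_hermitian (isFlat_add_conj hBI hγI hβ hγ) h1 h2)
  · simp only [hIV, gamma_apply, hJ, map_neg]
    refine Prod.ext ?_ ?_
    · simp only [Prod.fst_sub]
      rw [hα X Y, hα (J X)]
    · simp only [Prod.snd_sub]
      rw [hα X (J Y), hα (J X) Y]
      abel
  · rw [Module.finrank_prod]
    omega

end Pairing

section Radical

variable {U : Type*} [NormedAddCommGroup U] [InnerProductSpace ℝ U]
  {V : Type*} [AddCommGroup V] [Module ℝ V]

theorem rotate_mem_radical {J : V →ₗ[ℝ] V} (hJ : ∀ X, J (J X) = -X) (α : V →ₗ[ℝ] V →ₗ[ℝ] U)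
    {v : U × U} (hv : v ∈ image (gamma J α) ⊓ (pairing U).orthogonal (image (gamma J α))) :
    rotate U v ∈ image (gamma J α) ⊓ (pairing U).orthogonal (image (gamma J α)) := by
  refine ⟨?_, mem_orthogonal_image.2 fun X Y => ?_⟩
  · have hle : image (gamma J α) ≤ (image (gamma J α)).comap (rotate U) := by
      refine Submodule.span_le.2 ?_
      rintro _ ⟨X, Y, rfl⟩
      change rotate U (gamma J α X Y) ∈ image (gamma J α)
      rw [← gamma_apply_J hJ]
      exact apply_mem_image _ _ _
    exact hle hv.1
  · rw [← pairing_rotate, ← gamma_apply_J hJ]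
    exact mem_orthogonal_image.1 hv.2 _ _

/-- The complex structure on `Ω` sends `ξ` to the unique `η` such that `(ξ, η)` belongs to
`S(γ) ∩ S(γ)^⊥`. -/
theorem exists_complexStructure {J : V →ₗ[ℝ] V} (hJ : ∀ X, J (J X) = -X)
    (α : V →ₗ[ℝ] V →ₗ[ℝ] U) :
    ∃ 𝒥 : omega (gamma J α) →ₗ[ℝ] omega (gamma J α),
      (∀ ξ, 𝒥 (𝒥 ξ) = -ξ) ∧ (∀ ξ η, inner ℝ (𝒥 ξ) (𝒥 η) = inner ℝ ξ η) ∧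
      (∀ ξ : omega (gamma J α), ((ξ : U), (𝒥 ξ : U)) ∈
        image (gamma J α) ⊓ (pairing U).orthogonal (image (gamma J α))) := by
  set R := image (gamma J α) ⊓ (pairing U).orthogonal (image (gamma J α)) with hR
  have hnull : ∀ v ∈ R, ∀ w ∈ R, (inner ℝ v.1 w.1 : ℝ) = inner ℝ v.2 w.2 := fun v hv w hw =>
    sub_eq_zero.1 (hw.2 v hv.1)
  let g : R →ₗ[ℝ] omega (gamma J α) :=
    ((LinearMap.fst ℝ U U).comp R.subtype).codRestrict _ fun v => ⟨v, v.2, rfl⟩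
  have hg : ∀ v : R, (g v : U) = (v : U × U).1 := fun _ => rfl
  have hinj : Function.Injective g := by
    rw [← LinearMap.ker_eq_bot, eq_bot_iff]
    intro v hv
    have h1 : (v : U × U).1 = 0 := congrArg Subtype.val (show g v = 0 from hv)
    have h2 := hnull v v.2 v v.2
    rw [h1, inner_zero_left, eq_comm, inner_self_eq_zero] at h2
    exact Subtype.ext (Prod.ext h1 h2)
  have hsurj : Function.Surjective g := by
    rintro ⟨_, v, hv, rfl⟩
    exact ⟨⟨v, hv⟩, rfl⟩
  let e : R ≃ₗ[ℝ] omega (gamma J α) := LinearEquiv.ofBijective g ⟨hinj, hsurj⟩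
  let T : R →ₗ[ℝ] R := (rotate U).restrict fun v hv => rotate_mem_radical hJ α hv
  have heg : ∀ ξ, g (e.symm ξ) = ξ := fun ξ => e.apply_symm_apply ξ
  have hge : ∀ v, e.symm (g v) = v := fun v => e.symm_apply_apply v
  have hval : ∀ ξ, ((g ∘ₗ T ∘ₗ e.symm.toLinearMap) ξ : U) = (e.symm ξ : U × U).2 := fun _ => rfl
  have hfst : ∀ ξ : omega (gamma J α), (ξ : U) = (e.symm ξ : U × U).1 := fun ξ => by rw [← hg, heg]
  refine ⟨g ∘ₗ T ∘ₗ e.symm.toLinearMap, fun ξ => ?_, fun ξ η => ?_, fun ξ => ?_⟩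
  · refine Subtype.ext ?_
    change (e.symm (g (T (e.symm ξ))) : U × U).2 = -(ξ : U)
    rw [hge, hfst ξ]
    rfl
  · rw [Submodule.coe_inner, Submodule.coe_inner, hval, hval,
      ← hnull _ (e.symm ξ).2 _ (e.symm η).2, ← hfst, ← hfst]
  · have h1 : ((ξ : U), ((g ∘ₗ T ∘ₗ e.symm.toLinearMap) ξ : U)) = (e.symm ξ : U × U) :=
      Prod.ext (hfst ξ) (hval ξ)
    rw [h1]
    exact (e.symm ξ).2

variable [FiniteDimensional ℝ U]

theorem inner_proj (L : Submodule ℝ U) (u : U) (ξ : L) :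
    (inner ℝ (proj L u) ξ : ℝ) = inner ℝ u (ξ : U) :=
  Submodule.inner_orthogonalProjectionOnto_eq_of_mem_right ξ u

theorem inner_eq_inner_proj_add (L : Submodule ℝ U) (u v : U) :
    (inner ℝ u v : ℝ) =
      inner ℝ (proj L u) (proj L v) + inner ℝ (proj Lᗮ u) (proj Lᗮ v) := by
  rw [inner_proj, inner_proj, ← inner_add_right]
  congr 1
  exact (L.starProjection_add_starProjection_orthogonal v).symm

/-- As `(ξ, 𝒥 ξ)` is orthogonal to the values of `γ`, the map `-𝒥`, which is the adjoint of `𝒥`,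
sends `α_Ω(X, JY)` to `α_Ω(X, Y)`. -/
theorem complexStructure_comp {J : V →ₗ[ℝ] V} {α : V →ₗ[ℝ] V →ₗ[ℝ] U}
    {𝒥 : omega (gamma J α) →ₗ[ℝ] omega (gamma J α)} (h1 : ∀ ξ, 𝒥 (𝒥 ξ) = -ξ)
    (h2 : ∀ ξ η, (inner ℝ (𝒥 ξ) (𝒥 η) : ℝ) = inner ℝ ξ η)
    (h3 : ∀ ξ : omega (gamma J α), ((ξ : U), (𝒥 ξ : U)) ∈
      image (gamma J α) ⊓ (pairing U).orthogonal (image (gamma J α))) (X Y : V) :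
    𝒥 (comp (omega (gamma J α)) α X Y) = comp (omega (gamma J α)) α X (J Y) := by
  refine ext_inner_right ℝ fun ξ => ?_
  have h := mem_orthogonal_image.1 (h3 (𝒥 ξ)).2 X Y
  rw [gamma_apply, pairing_apply] at h
  have h4 := h2 (comp (omega (gamma J α)) α X Y) (𝒥 ξ)
  rw [h1, inner_neg_right] at h4
  change (inner ℝ _ _ : ℝ) = inner ℝ (proj _ (α X (J Y))) ξ
  change -(inner ℝ _ _ : ℝ) = inner ℝ (proj _ (α X Y)) (𝒥 ξ) at h4
  rw [inner_proj] at h4 ⊢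
  simp only [h1, Submodule.coe_neg, inner_neg_right] at h
  linarith

/-- Dropping the `Ω`-components does not change the pairings of the values of `γ`: these components
are `(α_Ω(X, Y), 𝒥 α_Ω(X, Y))`, and such vectors pair to zero because `𝒥` is an isometry. -/
theorem pairing_compProd {J : V →ₗ[ℝ] V} (hJ : ∀ X, J (J X) = -X) {α : V →ₗ[ℝ] V →ₗ[ℝ] U}
    {P : Submodule ℝ U} (hP : P = (omega (gamma J α))ᗮ) (X Y Z T : V) :
    pairing P (compProd P (gamma J α) X Y) (compProd P (gamma J α) Z T) =
      pairing U (gamma J α X Y) (gamma J α Z T) := by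
  subst hP
  obtain ⟨𝒥, h1, h2, h3⟩ := exists_complexStructure hJ α
  have hc := complexStructure_comp h1 h2 h3
  have h4 := h2 (comp (omega (gamma J α)) α X Y) (comp (omega (gamma J α)) α Z T)
  rw [hc, hc] at h4
  rw [gamma_apply, gamma_apply, pairing_apply, pairing_apply,
    inner_eq_inner_proj_add (omega (gamma J α)) (α X Y),
    inner_eq_inner_proj_add (omega (gamma J α)) (α X (J Y))]
  change (inner ℝ (proj _ (α X (J Y))) (proj _ (α Z (J T))) : ℝ) =
    inner ℝ (proj _ (α X Y)) (proj _ (α Z T)) at h4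
  simp only [compProd, LinearMap.compr₂_apply, gamma_apply, LinearMap.prodMap_apply]
  linarith

theorem exists_mem_image_of_mem_image_compProd {γ : V →ₗ[ℝ] V →ₗ[ℝ] U × U} {P : Submodule ℝ U}
    {w : P × P} (hw : w ∈ image (compProd P γ)) :
    ∃ v ∈ image γ, (proj P).prodMap (proj P) v = w := by
  have hle : image (compProd P γ) ≤ (image γ).map ((proj P).prodMap (proj P)) := by
    refine Submodule.span_le.2 ?_
    rintro _ ⟨X, Y, rfl⟩
    exact ⟨γ X Y, apply_mem_image γ X Y, rfl⟩
  exact hle hw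

/-- A vector of `S(γ)` whose image in `S(γ_P)` is orthogonal to `S(γ_P)` lies in the radical of
`S(γ)`, hence in `Ω ⊕ Ω`. -/
theorem not_isDegenerate_compProd {J : V →ₗ[ℝ] V} (hJ : ∀ X, J (J X) = -X)
    {α : V →ₗ[ℝ] V →ₗ[ℝ] U} {P : Submodule ℝ U} (hP : P = (omega (gamma J α))ᗮ) :
    ¬ IsDegenerate (pairing P) (image (compProd P (gamma J α))) := by
  rw [IsDegenerate, not_not, eq_bot_iff]
  rintro w ⟨hw, hw'⟩
  obtain ⟨v, hv, rfl⟩ := exists_mem_image_of_mem_image_compProd hw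
  have hpair : ∀ X Y, ∀ u ∈ image (gamma J α), pairing P (compProd P (gamma J α) X Y)
      ((proj P).prodMap (proj P) u) = pairing U (gamma J α X Y) u := by
    intro X Y u hu
    induction hu using Submodule.span_induction with
    | mem u hu =>
      obtain ⟨Z, T, rfl⟩ := hu
      exact pairing_compProd hJ hP X Y Z T
    | zero => rw [map_zero, map_zero, map_zero]
    | add u u' _ _ hu hu' => rw [map_add, map_add, map_add, hu, hu']
    | smul c u _ hu => rw [map_smul, map_smul, map_smul, hu]
  have hvR : v ∈ image (gamma J α) ⊓ (pairing U).orthogonal (image (gamma J α)) :=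
    ⟨hv, mem_orthogonal_image.2 fun X Y => by
      rw [← hpair X Y v hv]
      exact mem_orthogonal_image.1 hw' X Y⟩
  have hproj : ∀ u ∈ omega (gamma J α), proj P u = 0 := fun u hu => by
    subst hP
    exact Submodule.orthogonalProjectionOnto_apply_of_mem_orthogonal
      (Submodule.le_orthogonal_orthogonal _ hu)
  exact Prod.ext (hproj _ ⟨v, hvR, rfl⟩) (hproj _ ⟨rotate U v, rotate_mem_radical hJ α hvR, rfl⟩)

theorem compProd_gamma (P : Submodule ℝ U) (J : V →ₗ[ℝ] V) (α : V →ₗ[ℝ] V →ₗ[ℝ] U) :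
    compProd P (gamma J α) = gamma J (comp P α) := by
  ext X Y
  · simp [compProd, gamma_apply, comp]
  · simp [compProd, gamma_apply, comp]

end Radical

end FlatForms

theorem theorem3
    {V U : Type*} [AddCommGroup V] [Module ℝ V] [FiniteDimensional ℝ V]
    [NormedAddCommGroup U] [InnerProductSpace ℝ U] [FiniteDimensional ℝ U]
    (n p : ℕ)
    (hV : Module.finrank ℝ V = 2 * n) (hU : Module.finrank ℝ U = p)
    (J : V →ₗ[ℝ] V) (hJ : ∀ X, J (J X) = -X)
    (α : V →ₗ[ℝ] V →ₗ[ℝ] U) (hα : ∀ X Y, α X Y = α Y X)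
    (hpn : p ≤ n) (hp : p ≤ 11)
    (hγ : FlatForms.IsFlat (FlatForms.pairing U) (FlatForms.gamma J α))
    (hβ : FlatForms.IsFlat (FlatForms.pairing U) (FlatForms.beta J α))
    (hmixed : ∀ X Y Z T : V,
      FlatForms.pairing U (FlatForms.beta J α X Y) (FlatForms.gamma J α Z T)
        = FlatForms.pairing U (FlatForms.beta J α X T) (FlatForms.gamma J α Z Y))
    (hν : (FlatForms.nu (FlatForms.gamma J α) : ℤ)
      < 2 * (n : ℤ) - (Module.finrank ℝ (FlatForms.image (FlatForms.gamma J α)) : ℤ)) :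
    FlatForms.IsDegenerate (FlatForms.pairing U) (FlatForms.image (FlatForms.gamma J α)) ∧
    ∀ Ω P : Submodule ℝ U, Ω = FlatForms.omega (FlatForms.gamma J α) → P = Ωᗮ →
      (∃ 𝒥 : Ω →ₗ[ℝ] Ω,
        (∀ ξ, 𝒥 (𝒥 ξ) = -ξ) ∧
        (∀ ξ η, inner ℝ (𝒥 ξ) (𝒥 η) = inner ℝ ξ η) ∧
        ∀ X Y, 𝒥 (FlatForms.comp Ω α X Y) = FlatForms.comp Ω α X (J Y)) ∧
      (FlatForms.IsFlat (FlatForms.pairing P) (FlatForms.compProd P (FlatForms.gamma J α)) ∧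
        ¬ FlatForms.IsDegenerate (FlatForms.pairing P)
          (FlatForms.image (FlatForms.compProd P (FlatForms.gamma J α))) ∧
        2 * (n : ℤ) - (Module.finrank ℝ
            (FlatForms.image (FlatForms.compProd P (FlatForms.gamma J α))) : ℤ)
          ≤ (FlatForms.nu (FlatForms.compProd P (FlatForms.gamma J α)) : ℤ)) := by

  refine ⟨?_, ?_⟩
  · by_contra hnd
    have h := FlatForms.finrank_le_nu_gamma_add (hU.trans_le hp) hJ hα hγ hnd
    omega
  · rintro Ω P rfl hP
    obtain ⟨𝒥, h1, h2, h3⟩ := FlatForms.exists_complexStructure hJ α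
    have hflat : FlatForms.IsFlat (FlatForms.pairing P)
        (FlatForms.compProd P (FlatForms.gamma J α)) := fun X Z Y T => by
      rw [FlatForms.pairing_compProd hJ hP, FlatForms.pairing_compProd hJ hP]
      exact hγ X Z Y T
    have hnd := FlatForms.not_isDegenerate_compProd hJ (α := α) hP
    refine ⟨⟨𝒥, h1, h2, FlatForms.complexStructure_comp h1 h2 h3⟩, hflat, hnd, ?_⟩
    rw [FlatForms.compProd_gamma] at hflat hnd ⊢
    have h := FlatForms.finrank_le_nu_gamma_add
      ((Submodule.finrank_le P).trans (hU.trans_le hp)) hJ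
      (fun X Y => by simp only [FlatForms.comp, LinearMap.compr₂_apply, hα X Y]) hflat hnd
    omega
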